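/- Let $N\ge 1$, let $\Omega\subset\mathbb R^N$ be a bounded open convex polyhedral domain (the nonempty interior of a convex polytope), and let $s\in(0,1)$, $m>0$, $T>0$. Let $u_0\in L^\infty(\mathbb R^N)$ with $u_0=0$ outside $\Omega$. Write $$\mathcal E(v,\varphi):=\int_{\mathbb R^N}\int_{\mathbb R^N}\frac{(v(x)-v(z))(\varphi(x)-\varphi(z))}{|x-z|^{N+2s}}\,dz\,dx,\qquad \psi(y):=|y|^{\frac{1-m}{m}}y,\qquad \psi^{-1}(y)=|y|^{m-1}y .$$ *Weak solution.* Let $u$ be a weak solution of $u_t=-(-\Delta)^s(|u|^{m-1}u)$ in $\Omega\times(0,T]$, $u=0$ on $(\mathbb R^N\setminus\Omega)\times[0,T]$, $u(\cdot,0)=u_0$; that is, $u\in C([0,T];L^{m+1}(\mathbb R^N))$ vanishes outside $\Omega$, $u(\cdot,0)=u_0$, the function $w:=|u|^{m-1}u$ belongs to $L^2(0,T;H^s(\mathbb R^N))$, and $$-\int_0^T\!\int_{\mathbb R^N}u\,\varphi_t\,dx\,dt+\int_0^T\mathcal E(w(t),\varphi(t))\,dt=\int_{\mathbb R^N}u_0\,\varphi(\cdot,0)\,dx$$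 for all Lipschitz functions $\varphi$ on $[0,T]\times\mathbb R^N$ with $\varphi=0$ outside $\Omega$ and $\varphi(\cdot,T)=0$. (Here the normalization constant of $(-\Delta)^s$ is such that its weak form is $\mathcal E$.) *Discretization.* For a conforming triangulation $T_h$ of $\overline\Omega$ into finitely many closed $N$-simplices with mesh size $h$, let $S_h$ be the space of functions that are continuous on $\overline\Omega$, affine on each simplex of $T_h$ and zero on $\mathbb R^N\setminus\Omega$. For a function $v$ vanishing outside $\Omega$, $\Pi_hv\in S_h$ is its piecewise linear interpolant at the vertices of $T_h$; for $v\in H^s(\mathbb R^N)$, $P_hv\in S_h$ is the $H^s$-projection, defined by $\mathcal E(v-P_hv,\chi)=0$ for all $\chi\in S_h$. Let $\tau>0$ and $M\in\mathbb N$ with $M\tau=T$, and put $t_n=n\tau$, $I_n=(t_{n-1},t_n)$, $w_n=w(\cdot,t_n)$. Put $W_0:=\psi^{-1}(\Pi_h\psi(w_0))$ and let $W_1,\dots,W_M\in S_h$ solve $$\int_\Omega\frac{\psi(W_n)-\psi(W_{n-1})}{\tau}\,\chi\,dx+\mathcal E(W_n,\chi)=0\qquad\forall\chi\in S_h,\quad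 1\le n\le M .$$ Let $W(\cdot,0)=W_0$ and $W(\cdot,t)=W_n$ for $t\in(t_{n-1},t_n]$. For $p>1$ define the quasi-norm by $$\|v_2\|_{(v_1,p)}^2:=\int_\Omega(|v_1|+|v_2|)^{p-2}|v_2|^2\,dx\in[0,\infty],$$ the integrand being $0$ where $v_2=0$. *Claim.* For every $\sigma>0$ there is a constant $c>0$, independent of $h$ and $\tau$, such that for every such triangulation satisfying the shape regularity condition $|S|\ge\sigma(\operatorname{diam}S)^N$ for all its simplices $S$, for all $\tau$, $M$ with $M\tau=T$ and for all $W_0,\dots,W_M$ as above, $$\int_0^T\|w-W\|_{(w,\frac{m+1}{m})}^2\,dt\le c\Bigg(\sum_{n=1}^M\int_{I_n}\|w_n-w\|_{(w,\frac{m+1}{m})}^2\,dt+\int_0^T\|w-P_hw\|_{(w,\frac{m+1}{m})}^2\,dt+\|\psi(w_0)-\Pi_h\psi(w_0)\|_{L^2(\mathbb R^N)}^2\Bigg).$$ -/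

import Mathlib

open MeasureTheory Set Filter Topology

noncomputable section

namespace FracFastDiffusion

/-- `ψ(y) = |y|^{(1-m)/m} y`. -/
def psi (m y : ℝ) : ℝ := |y| ^ ((1 - m) / m) * y

/-- `ψ⁻¹(y) = |y|^{m-1} y`. -/
def psiInv (m y : ℝ) : ℝ := |y| ^ (m - 1) * y

/-- The function `w = |u|^{m-1} u`, for a function `u t x` of time and space. -/
def wOf {N : ℕ} (m : ℝ) (u : ℝ → EuclideanSpace ℝ (Fin N) → ℝ) :
    ℝ → EuclideanSpace ℝ (Fin N) → ℝ :=
  fun t x => |u t x| ^ (m - 1) * u t x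

/-- A bounded open convex polyhedral domain: the nonempty interior of a convex polytope. -/
def IsConvexPolyhedralDomain {N : ℕ} (Ω : Set (EuclideanSpace ℝ (Fin N))) : Prop :=
  Ω.Nonempty ∧
    ∃ F : Finset (EuclideanSpace ℝ (Fin N)),
      Ω = interior (convexHull ℝ (F : Set (EuclideanSpace ℝ (Fin N))))

/-- The square `|v|²_{H^s(ℝ^N)}` of the Gagliardo seminorm, with values in `[0, ∞]`. -/
def gagliardoSq {N : ℕ} (s : ℝ) (v : EuclideanSpace ℝ (Fin N) → ℝ) : ENNReal :=
  ∫⁻ x, ∫⁻ z, ENNReal.ofReal ((v x - v z) ^ 2 / ‖x - z‖ ^ ((N : ℝ) + 2 * s))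

/-- The squared `H^s(ℝ^N)` norm, with values in `[0, ∞]`. -/
def sobolevNormSq {N : ℕ} (s : ℝ) (v : EuclideanSpace ℝ (Fin N) → ℝ) : ENNReal :=
  eLpNorm v 2 volume ^ 2 + gagliardoSq s v

/-- The bilinear form
`∫ ∫ (v(x) - v(z)) (φ(x) - φ(z)) / |x - z|^{N+2s} dz dx` (for `v, φ ∈ H^s(ℝ^N)`). -/
def energyForm {N : ℕ} (s : ℝ) (v φ : EuclideanSpace ℝ (Fin N) → ℝ) : ℝ :=
  ∫ x, ∫ z, (v x - v z) * (φ x - φ z) / ‖x - z‖ ^ ((N : ℝ) + 2 * s)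

/-- The squared quasi-norm `‖v₂‖²_{(v₁,p)} = ∫_Ω (|v₁| + |v₂|)^{p-2} |v₂|²`,
with values in `[0, ∞]`. The integrand is `0` where `v₂ = 0`. -/
def quasiNormSq {N : ℕ} (Ω : Set (EuclideanSpace ℝ (Fin N))) (p : ℝ)
    (v₁ v₂ : EuclideanSpace ℝ (Fin N) → ℝ) : ENNReal :=
  ∫⁻ x in Ω, ENNReal.ofReal ((|v₁ x| + |v₂ x|) ^ (p - 2) * |v₂ x| ^ 2)

/-- Test functions of the weak formulation: functions on `[0,T] × ℝ^N` that are Lipschitz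
continuous, vanish outside `Ω` and vanish at the final time `T`. -/
structure IsTestFunction {N : ℕ} (Ω : Set (EuclideanSpace ℝ (Fin N))) (T : ℝ)
    (φ : ℝ → EuclideanSpace ℝ (Fin N) → ℝ) : Prop where
  lipschitz : ∃ L : NNReal,
    LipschitzOnWith L (fun q : ℝ × EuclideanSpace ℝ (Fin N) => φ q.1 q.2) (Icc 0 T ×ˢ univ)
  zero_outside : ∀ t ∈ Icc 0 T, ∀ x ∉ Ω, φ t x = 0
  final : ∀ x, φ T x = 0

/-- Weak solutions of `u_t = -(-Δ)^s (|u|^{m-1} u)` in `Ω × (0,T]`, `u = 0` outside `Ω`,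
`u(0) = u₀`, in the energy class `u ∈ C([0,T]; L^{m+1})`, `|u|^{m-1} u ∈ L²(0,T; H^s(ℝ^N))`.
The time derivative of a (Lipschitz) test function exists almost everywhere. -/
structure IsWeakSolution {N : ℕ} (Ω : Set (EuclideanSpace ℝ (Fin N))) (s m T : ℝ)
    (u₀ : EuclideanSpace ℝ (Fin N) → ℝ) (u : ℝ → EuclideanSpace ℝ (Fin N) → ℝ) : Prop where
  measurable : AEStronglyMeasurable (fun q : ℝ × EuclideanSpace ℝ (Fin N) => u q.1 q.2)
    ((volume.restrict (Icc 0 T)).prod volume)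
  memLp : ∀ t ∈ Icc 0 T, MemLp (u t) (ENNReal.ofReal (m + 1)) volume
  continuous : ∀ t ∈ Icc 0 T,
    Tendsto (fun r => eLpNorm (fun x => u r x - u t x) (ENNReal.ofReal (m + 1)) volume)
      (𝓝[Icc 0 T] t) (𝓝 0)
  energy : ∫⁻ t in Ioo 0 T, sobolevNormSq s (wOf m u t) < ⊤
  zero_outside : ∀ t ∈ Icc 0 T, ∀ x ∉ Ω, u t x = 0
  initial : u 0 = u₀
  weak : ∀ φ : ℝ → EuclideanSpace ℝ (Fin N) → ℝ, IsTestFunction Ω T φ →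
    -(∫ t in Ioo 0 T, ∫ x, u t x * deriv (fun r => φ r x) t) +
        ∫ t in Ioo 0 T, energyForm s (wOf m u t) (φ t)
      = ∫ x, u₀ x * φ 0 x

/-- `K` is a conforming triangulation of `closure Ω` into finitely many closed `N`-simplices
(the convex hulls of the faces with `N + 1` vertices), shape regular with constant `σ`:
`|S| ≥ σ (diam S)^N` for all its `N`-simplices `S`. -/
structure IsTriangulation {N : ℕ} (Ω : Set (EuclideanSpace ℝ (Fin N))) (σ : ℝ)
    (K : Geometry.SimplicialComplex ℝ (EuclideanSpace ℝ (Fin N))) : Prop where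
  finite : K.faces.Finite
  space_eq : K.space = closure Ω
  pure : ∀ f ∈ K.faces, ∃ g ∈ K.faces, f ⊆ g ∧ g.card = N + 1
  regular : ∀ f ∈ K.faces, f.card = N + 1 →
    σ * Metric.diam (convexHull ℝ (f : Set (EuclideanSpace ℝ (Fin N)))) ^ N
      ≤ volume.real (convexHull ℝ (f : Set (EuclideanSpace ℝ (Fin N))))

/-- The finite element space `S_h`: functions that are continuous on `closure Ω`, affine on every
simplex of the triangulation, and zero outside `Ω`. -/
def femSpace {N : ℕ} (Ω : Set (EuclideanSpace ℝ (Fin N)))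
    (K : Geometry.SimplicialComplex ℝ (EuclideanSpace ℝ (Fin N))) :
    Submodule ℝ (EuclideanSpace ℝ (Fin N) → ℝ) where
  carrier := {φ | ContinuousOn φ (closure Ω) ∧ (∀ x ∉ Ω, φ x = 0) ∧
    ∀ f ∈ K.faces, ∃ A : EuclideanSpace ℝ (Fin N) →ᵃ[ℝ] ℝ,
      EqOn φ A (convexHull ℝ (f : Set (EuclideanSpace ℝ (Fin N))))}
  zero_mem' := ⟨continuousOn_const, fun _ _ => rfl, fun _ _ => ⟨0, fun _ _ => rfl⟩⟩
  add_mem' := by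
    rintro φ χ ⟨h1, h2, h3⟩ ⟨k1, k2, k3⟩
    refine ⟨h1.add k1, fun x hx => by simp [h2 x hx, k2 x hx], fun f hf => ?_⟩
    obtain ⟨A, hA⟩ := h3 f hf
    obtain ⟨B, hB⟩ := k3 f hf
    exact ⟨A + B, fun x hx => by simp [hA hx, hB hx]⟩
  smul_mem' := by
    rintro c φ ⟨h1, h2, h3⟩
    refine ⟨h1.const_smul c, fun x hx => by simp [h2 x hx], fun f hf => ?_⟩
    obtain ⟨A, hA⟩ := h3 f hf
    exact ⟨c • A, fun x hx => by simp [hA hx]⟩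

open Classical in
/-- The piecewise linear interpolation `Π_h v` of a function `v` that vanishes outside `Ω`:
the element of `S_h` that agrees with `v` at all vertices of the triangulation. -/
def interpolant {N : ℕ} (Ω : Set (EuclideanSpace ℝ (Fin N)))
    (K : Geometry.SimplicialComplex ℝ (EuclideanSpace ℝ (Fin N)))
    (v : EuclideanSpace ℝ (Fin N) → ℝ) : EuclideanSpace ℝ (Fin N) → ℝ :=
  if h : ∃ q ∈ femSpace Ω K, ∀ a ∈ K.vertices, q a = v a then h.choose else 0

open Classical in
/-- The `H^s`-projection `P_h v` of `v ∈ H^s(ℝ^N)`: the element of `S_h` such that the energy form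
of `v - P_h v` and `χ` vanishes for all `χ ∈ S_h`. -/
def hsProjection {N : ℕ} (Ω : Set (EuclideanSpace ℝ (Fin N))) (s : ℝ)
    (K : Geometry.SimplicialComplex ℝ (EuclideanSpace ℝ (Fin N)))
    (v : EuclideanSpace ℝ (Fin N) → ℝ) : EuclideanSpace ℝ (Fin N) → ℝ :=
  if h : ∃ q ∈ femSpace Ω K, ∀ χ ∈ femSpace Ω K, energyForm s (fun x => v x - q x) χ = 0
  then h.choose else 0

/-- `W 0, …, W M` solve the fully discrete (backward Euler) scheme with time step `τ`, started from
`W 0 = ψ⁻¹(Π_h ψ(w₀))`. -/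
structure IsDiscreteSolution {N : ℕ} (Ω : Set (EuclideanSpace ℝ (Fin N))) (s m : ℝ)
    (K : Geometry.SimplicialComplex ℝ (EuclideanSpace ℝ (Fin N))) (τ : ℝ) (M : ℕ)
    (w₀ : EuclideanSpace ℝ (Fin N) → ℝ) (W : ℕ → EuclideanSpace ℝ (Fin N) → ℝ) : Prop where
  initial : W 0 = fun x => psiInv m (interpolant Ω K (fun y => psi m (w₀ y)) x)
  mem : ∀ n < M, W (n + 1) ∈ femSpace Ω K
  eq : ∀ n < M, ∀ χ ∈ femSpace Ω K,
    (∫ x in Ω, (psi m (W (n + 1) x) - psi m (W n x)) / τ * χ x) +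
      energyForm s (W (n + 1)) χ = 0

/-- The piecewise constant in time function that is `W 0` at `t = 0` and `W n` for
`t ∈ ((n - 1) τ, n τ]`. -/
def stepInTime {N : ℕ} (τ : ℝ) (W : ℕ → EuclideanSpace ℝ (Fin N) → ℝ) :
    ℝ → EuclideanSpace ℝ (Fin N) → ℝ :=
  fun t => W ⌈t / τ⌉₊

end FracFastDiffusion

end

/-!
The estimate rests on testing the error equation with a time integral of the error itself, instead
of with a time derivative, which the solution need not have.

Write `ψ(y) = |y|^{(1-m)/m} y`, so that `u = ψ(w)`, and `tₙ = nτ`. Letting a time cut-off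
degenerate, the weak formulation gives `(u(tₙ) - u₀, χ) + ∫_0^{tₙ} E(w, χ) dt = 0` for every
finite element function `χ` (`IsWeakSolution.integral_eq`); this uses that finite element
functions are Lipschitz on the whole space (`lipschitzWith_of_mem_femSpace`) and that `u` is
continuous in time. Subtracting the summed scheme and replacing `w` by its projection inside `E`,
one finds `(u(tₙ) - ψ(Wₙ), χ) + E(X_n, χ) = (u₀ - Π_h u₀, χ)` with `X_n = ∑_{j ≤ n} ∫_{I_j} (P_h w
- W_j) dt`. The choice `χ = X_n - X_{n-1}` and summation over `n` leave `½ E(X_M, X_M)` on the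
left (`sum_add_half_le_of_increments`). A fractional Poincaré inequality (`exists_poincare`)
absorbs the contribution of the initial error into it.

What remains is `∑ ∫_{I_n} (ψ(w(tₙ)) - ψ(Wₙ), P_h w - Wₙ) dt`. Its principal part is the
monotonicity gap `(ψ(a) - ψ(b)) (a - b)` at `a = w(tₙ)`, `b = Wₙ`, which is comparable to the
quasi-norm integrand. All perturbations are handled by pointwise inequalities for this gap, namely
a Young inequality and a quasi-triangle inequality (`exists_psi_young`, `exists_psiGap_triangle`),
and both follow from the doubling property of the increments of `ψ`
(`exists_psi_sub_le_of_abs_le`). The constant depends only on `Ω`, `s`, `m` and `N`.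

Two points need care in the formal setting. The projection `P_h w(t)` is defined by choice at each
time, so its pairings are rewritten through Riesz representatives as energy forms of `w(t)`, which
are measurable in `t` (`pairing_time_integral_hsProjection`). The interpolant of `u₀` enters only
as an element of the finite element space.
-/

noncomputable section

namespace FracFastDiffusion

/-! ### Pointwise inequalities for the power nonlinearity -/

lemma exponent_gt {m : ℝ} (hm : 0 < m) : -1 < (1 - m) / m := by
  rw [lt_div_iff₀ hm]; linarith

lemma psi_zero (m : ℝ) : psi m 0 = 0 := by simp [psi]

lemma psi_neg (m y : ℝ) : psi m (-y) = -psi m y := by simp [psi]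

lemma psi_of_nonneg {m : ℝ} (hm : 0 < m) {y : ℝ} (hy : 0 ≤ y) : psi m y = y ^ (1 / m) := by
  rcases hy.eq_or_lt with rfl | h
  · rw [psi_zero, Real.zero_rpow (by positivity)]
  · rw [psi, abs_of_pos h]
    nth_rewrite 2 [← Real.rpow_one y]
    rw [← Real.rpow_add h]
    congr 1
    field_simp
    ring

lemma psi_mul {m : ℝ} {r : ℝ} (hr : 0 ≤ r) (hm : 0 < m) (y : ℝ) :
    psi m (r * y) = r ^ (1 / m) * psi m y := by
  rcases le_total 0 y with h | h
  · rw [psi_of_nonneg hm h, psi_of_nonneg hm (mul_nonneg hr h), Real.mul_rpow hr h]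
  · have h' : 0 ≤ -y := by linarith
    have e1 : psi m y = -psi m (-y) := by rw [psi_neg]; ring
    have e2 : psi m (r * y) = -psi m (r * -y) := by rw [mul_neg, psi_neg]; ring
    rw [e1, e2, psi_of_nonneg hm h', psi_of_nonneg hm (mul_nonneg hr h'), Real.mul_rpow hr h']
    ring

lemma one_sub_rpow_bounds {a t : ℝ} (ha : 0 < a) (h0 : 0 ≤ t) (h1 : t ≤ 1) :
    min 1 a * (1 - t) ≤ 1 - t ^ a ∧ 1 - t ^ a ≤ max 1 a * (1 - t) := by
  rcases le_total a 1 with h | h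
  · rw [min_eq_right h, max_eq_left h]
    constructor
    · have := rpow_one_add_le_one_add_mul_self (s := t - 1) (by linarith) ha.le h
      rw [show 1 + (t - 1) = t by ring] at this
      linarith
    · have := Real.rpow_le_rpow_of_exponent_ge' h0 h1 ha.le h
      rw [Real.rpow_one] at this
      linarith
  · rw [min_eq_left h, max_eq_right h]
    constructor
    · have := Real.rpow_le_rpow_of_exponent_ge' h0 h1 zero_le_one h
      rw [Real.rpow_one] at this
      linarith
    · have := one_add_mul_self_le_rpow_one_add (s := t - 1) (by linarith) h
      rw [show 1 + (t - 1) = t by ring] at this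
      linarith

lemma one_sub_psi_bounds {m t : ℝ} (hm : 0 < m) (h0 : -1 ≤ t) (h1 : t ≤ 1) :
    min 1 (1 / m) / 2 * (1 - t) ≤ 1 - psi m t ∧
      1 - psi m t ≤ 2 * max 1 (1 / m) * (1 - t) := by
  have ha : 0 < 1 / m := by positivity
  have i1 : 0 < min 1 (1 / m) := lt_min one_pos ha
  have i2 : min 1 (1 / m) ≤ 1 := min_le_left _ _
  have i3 : 1 ≤ max 1 (1 / m) := le_max_left _ _
  rcases le_total 0 t with h | h
  · obtain ⟨p, q⟩ := one_sub_rpow_bounds ha h h1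
    rw [psi_of_nonneg hm h]
    constructor <;> nlinarith
  · have e : psi m t = -(-t) ^ (1 / m) := by
      rw [← psi_of_nonneg hm (by linarith : 0 ≤ -t), psi_neg]; ring
    have j0 : 0 ≤ (-t) ^ (1 / m) := Real.rpow_nonneg (by linarith) _
    have j1 : (-t) ^ (1 / m) ≤ 1 := Real.rpow_le_one (by linarith) (by linarith) ha.le
    rw [e]
    constructor <;> nlinarith

/-- Comparison with the larger of the two moduli; the homogeneity of `psi` reduces it to
`one_sub_psi_bounds`. -/
lemma abs_psi_sub_bounds_max {m : ℝ} (hm : 0 < m) (a b : ℝ) (h : |b| ≤ |a|) :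
    min 1 (1 / m) / 2 * (|a| ^ ((1 - m) / m) * |a - b|) ≤ |psi m a - psi m b| ∧
      |psi m a - psi m b| ≤ 2 * max 1 (1 / m) * (|a| ^ ((1 - m) / m) * |a - b|) := by
  wlog ha : 0 ≤ a generalizing a b
  · have := this (-a) (-b) (by simpa using h) (by linarith)
    rw [psi_neg, psi_neg, abs_neg, show -a - -b = -(a - b) by ring, abs_neg,
      show -psi m a - -psi m b = -(psi m a - psi m b) by ring, abs_neg] at this
    exact this
  rcases ha.eq_or_lt with rfl | ha
  · have : b = 0 := by simpa using h
    subst this; simp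
  rw [abs_of_pos ha] at h ⊢
  obtain ⟨t, rfl⟩ : ∃ t, b = a * t := ⟨b / a, by field_simp⟩
  rw [abs_mul, abs_of_pos ha] at h
  have ht : |t| ≤ 1 := by
    by_contra hc
    nlinarith [not_le.1 hc]
  obtain ⟨h0, h1⟩ := abs_le.1 ht
  obtain ⟨p, q⟩ := one_sub_psi_bounds hm h0 h1
  have e1 : psi m a - psi m (a * t) = a ^ (1 / m) * (1 - psi m t) := by
    rw [psi_mul ha.le hm, psi_of_nonneg hm ha.le]; ring
  have e2 : |a - a * t| = a * (1 - t) := by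
    rw [abs_of_nonneg (by nlinarith)]; ring
  have e3 : a ^ ((1 - m) / m) * (a * (1 - t)) = a ^ (1 / m) * (1 - t) := by
    rw [← psi_of_nonneg hm ha.le, psi, abs_of_pos ha]; ring
  have hA : 0 < a ^ (1 / m) := by positivity
  have j : 0 ≤ 1 - psi m t := by
    have : 0 < min 1 (1 / m) := lt_min one_pos (by positivity)
    exact le_trans (mul_nonneg (by positivity) (by linarith)) p
  rw [e1, e2, e3, abs_of_nonneg (mul_nonneg hA.le j)]
  constructor <;> nlinarith

lemma rpow_comparable {e x y : ℝ} (hx : 0 ≤ x) (hxy : x ≤ y) (hyx : y ≤ 3 * x) :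
    (3 : ℝ) ^ (-|e|) * x ^ e ≤ y ^ e ∧ y ^ e ≤ (3 : ℝ) ^ |e| * x ^ e := by
  rcases hx.eq_or_lt with rfl | hx
  · have : y = 0 := by linarith
    subst this
    have h0 : (0 : ℝ) ≤ 0 ^ e := Real.rpow_nonneg le_rfl _
    have h1 : (3 : ℝ) ^ (-|e|) ≤ 1 := Real.rpow_le_one_of_one_le_of_nonpos (by norm_num) (by simp)
    have h2 : 1 ≤ (3 : ℝ) ^ |e| := Real.one_le_rpow (by norm_num) (abs_nonneg _)
    constructor <;> nlinarith
  obtain ⟨l, rfl⟩ : ∃ l, y = x * l := ⟨y / x, by field_simp⟩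
  have l1 : 1 ≤ l := by by_contra hc; nlinarith [not_le.1 hc]
  have l3 : l ≤ 3 := by by_contra hc; nlinarith [not_le.1 hc]
  rw [Real.mul_rpow hx.le (by linarith), mul_comm (x ^ e)]
  have hA : 0 < x ^ e := by positivity
  have up : l ^ e ≤ (3 : ℝ) ^ |e| :=
    (Real.rpow_le_rpow_of_exponent_le l1 (le_abs_self e)).trans
      (Real.rpow_le_rpow (by linarith) l3 (abs_nonneg _))
  have lo : (3 : ℝ) ^ (-|e|) ≤ l ^ e := by
    refine le_trans ?_ (Real.rpow_le_rpow_of_exponent_le l1 (neg_abs_le e))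
    rw [Real.rpow_neg (by norm_num), Real.rpow_neg (by linarith)]
    exact inv_anti₀ (by positivity) (Real.rpow_le_rpow (by linarith) l3 (abs_nonneg _))
  exact ⟨mul_le_mul_of_nonneg_right lo hA.le, mul_le_mul_of_nonneg_right up hA.le⟩

/-- The increments of `psi` at `a` are comparable to `(|a| + |a - b|)^{(1-m)/m} |a - b|`. -/
lemma exists_psi_sub_bounds {m : ℝ} (hm : 0 < m) : ∃ k K : ℝ, 0 < k ∧ 0 < K ∧ ∀ a b : ℝ,
    k * ((|a| + |a - b|) ^ ((1 - m) / m) * |a - b|) ≤ |psi m a - psi m b| ∧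
      |psi m a - psi m b| ≤ K * ((|a| + |a - b|) ^ ((1 - m) / m) * |a - b|) := by
  set e := (1 - m) / m with he
  set k0 := min 1 (1 / m) / 2 with hk0
  set K0 := 2 * max 1 (1 / m) with hK0
  have k0p : 0 < k0 := half_pos (lt_min one_pos (by positivity))
  have K0p : 0 < K0 := mul_pos two_pos (lt_max_of_lt_left one_pos)
  have c1 : (0 : ℝ) < 3 ^ (-|e|) := by positivity
  have c2 : (0 : ℝ) < 3 ^ |e| := by positivity
  have cc : (3 : ℝ) ^ (-|e|) * 3 ^ |e| = 1 := by
    rw [← Real.rpow_add (by norm_num)]; simp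
  refine ⟨k0 * 3 ^ (-|e|), K0 * 3 ^ |e|, by positivity, by positivity, fun a b => ?_⟩
  have key : ∀ M : ℝ, M ≤ |a| + |a - b| → |a| + |a - b| ≤ 3 * M → 0 ≤ M →
      k0 * (M ^ e * |a - b|) ≤ |psi m a - psi m b| →
      |psi m a - psi m b| ≤ K0 * (M ^ e * |a - b|) →
      k0 * 3 ^ (-|e|) * ((|a| + |a - b|) ^ e * |a - b|) ≤ |psi m a - psi m b| ∧
      |psi m a - psi m b| ≤ K0 * 3 ^ |e| * ((|a| + |a - b|) ^ e * |a - b|) := by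
    intro M h1 h2 h0 h3 h4
    obtain ⟨p, q⟩ := rpow_comparable (e := e) h0 h1 h2
    have hn := abs_nonneg (a - b)
    constructor
    · refine le_trans ?_ h3
      have q' : 3 ^ (-|e|) * (|a| + |a - b|) ^ e ≤ M ^ e := by
        calc 3 ^ (-|e|) * (|a| + |a - b|) ^ e ≤ 3 ^ (-|e|) * (3 ^ |e| * M ^ e) := by gcongr
          _ = M ^ e := by rw [← mul_assoc, cc, one_mul]
      calc k0 * 3 ^ (-|e|) * ((|a| + |a - b|) ^ e * |a - b|)
          = k0 * ((3 ^ (-|e|) * (|a| + |a - b|) ^ e) * |a - b|) := by ring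
        _ ≤ k0 * (M ^ e * |a - b|) := by gcongr
    · refine le_trans h4 ?_
      have p' : M ^ e ≤ 3 ^ |e| * (|a| + |a - b|) ^ e := by
        calc M ^ e = 3 ^ |e| * (3 ^ (-|e|) * M ^ e) := by
              rw [← mul_assoc, mul_comm (3 ^ |e|), cc, one_mul]
          _ ≤ _ := by gcongr
      calc K0 * (M ^ e * |a - b|) ≤ K0 * ((3 ^ |e| * (|a| + |a - b|) ^ e) * |a - b|) := by gcongr
        _ = _ := by ring
  have t1 : |b| ≤ |a| + |a - b| := by
    have := abs_sub_abs_le_abs_sub b a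
    rw [abs_sub_comm] at this; linarith
  have t2 : |a - b| ≤ |a| + |b| := abs_sub a b
  rcases le_total |b| |a| with h | h
  · obtain ⟨p, q⟩ := abs_psi_sub_bounds_max hm a b h
    exact key |a| (by linarith [abs_nonneg (a - b)]) (by linarith) (abs_nonneg _) p q
  · obtain ⟨p, q⟩ := abs_psi_sub_bounds_max hm b a h
    rw [abs_sub_comm b a, abs_sub_comm (psi m b)] at p q
    exact key |b| t1 (by linarith) (abs_nonneg _) p q

lemma add_rpow_mul_le {e A x y l : ℝ} (he : -1 < e) (hA : 0 ≤ A) (hx : 0 ≤ x) (hy : 0 ≤ y)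
    (hl : 1 ≤ l) (h : x ≤ l * y) :
    (A + x) ^ e * x ≤ l ^ (|e| + 1) * ((A + y) ^ e * y) := by
  have hl0 : 0 < l := by linarith
  have hle : l ≤ l ^ (|e| + 1) := by
    conv_lhs => rw [← Real.rpow_one l]
    exact Real.rpow_le_rpow_of_exponent_le hl (by linarith [abs_nonneg e])
  have hsplit : l ^ (|e| + 1) = l ^ |e| * l := by rw [Real.rpow_add hl0, Real.rpow_one]
  have h1e : 1 ≤ l ^ |e| := Real.one_le_rpow hl (abs_nonneg _)
  rcases hx.eq_or_lt with rfl | hx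
  · simp only [mul_zero]; positivity
  have hy : 0 < y := by
    rcases hy.eq_or_lt with rfl | hy
    · simp at h; linarith
    · exact hy
  rcases le_total 0 e with h0 | h0
  · rw [abs_of_nonneg h0] at *
    have : (A + x) ^ e ≤ l ^ e * (A + y) ^ e := by
      rw [← Real.mul_rpow hl0.le (by positivity)]
      exact Real.rpow_le_rpow (by positivity) (by nlinarith) h0
    calc (A + x) ^ e * x ≤ (l ^ e * (A + y) ^ e) * (l * y) := by gcongr
      _ = _ := by rw [hsplit]; ring
  · -- `(A + x)^e x = (A + x)^{e+1} · x / (A + x)`, a product of increasing functions of `x`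
    rcases le_total x y with hxy | hxy
    · have a1 : (A + x) ^ (e + 1) ≤ (A + y) ^ (e + 1) :=
        Real.rpow_le_rpow (by positivity) (by linarith) (by linarith)
      have a2 : x / (A + x) ≤ y / (A + y) := by
        rw [div_le_div_iff₀ (by positivity) (by positivity)]; nlinarith
      have a3 : ∀ z, 0 < z → (A + z) ^ e * z = (A + z) ^ (e + 1) * (z / (A + z)) := by
        intro z hz
        rw [Real.rpow_add (by positivity), Real.rpow_one]
        field_simp
      have a4 : (A + x) ^ e * x ≤ (A + y) ^ e * y := by
        rw [a3 x hx, a3 y hy]; gcongr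
      have : 0 ≤ (A + y) ^ e * y := by positivity
      nlinarith
    · have a1 : (A + x) ^ e ≤ (A + y) ^ e :=
        Real.rpow_le_rpow_of_nonpos (by positivity) (by linarith) h0
      calc (A + x) ^ e * x ≤ (A + y) ^ e * (l * y) := by gcongr
        _ = l * ((A + y) ^ e * y) := by ring
        _ ≤ _ := by gcongr

/-- Doubling property of the increments of `psi` at a point. -/
lemma exists_psi_sub_le_of_abs_le {m l : ℝ} (hm : 0 < m) (hl : 1 ≤ l) :
    ∃ C : ℝ, 0 < C ∧ ∀ a b c : ℝ, |a - b| ≤ l * |a - c| →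
      |psi m a - psi m b| ≤ C * |psi m a - psi m c| := by
  obtain ⟨k, K, hk, hK, H⟩ := exists_psi_sub_bounds hm
  have hl0 : 0 < l := by linarith
  refine ⟨K * l ^ (|(1 - m) / m| + 1) / k, by positivity, fun a b c h => ?_⟩
  refine (H a b).2.trans ?_
  have h1 := add_rpow_mul_le (exponent_gt hm) (abs_nonneg a) (abs_nonneg (a - b))
    (abs_nonneg (a - c)) hl h
  have h2 := (H a c).1
  calc _ ≤ K * (l ^ (|(1 - m) / m| + 1) *
        ((|a| + |a - c|) ^ ((1 - m) / m) * |a - c|)) := by gcongr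
    _ = K * l ^ (|(1 - m) / m| + 1) / k *
        (k * ((|a| + |a - c|) ^ ((1 - m) / m) * |a - c|)) := by field_simp
    _ ≤ _ := by gcongr

/-- The monotonicity gap `(ψ(a) - ψ(b)) (a - b)`, which is comparable to the integrand
`(|a| + |a - b|)^{p-2} |a - b|²` of the quasi-norm with `p = (m+1)/m`. -/
def psiGap (m a b : ℝ) : ℝ := (psi m a - psi m b) * (a - b)

lemma psiGap_comm (m a b : ℝ) : psiGap m a b = psiGap m b a := by unfold psiGap; ring

lemma psi_monotone {m : ℝ} (hm : 0 < m) : Monotone (psi m) := by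
  have pos : ∀ x y, 0 ≤ x → x ≤ y → psi m x ≤ psi m y := fun x y hx hxy => by
    rw [psi_of_nonneg hm hx, psi_of_nonneg hm (hx.trans hxy)]
    exact Real.rpow_le_rpow hx hxy (by positivity)
  intro x y hxy
  rcases le_total 0 x with h | h
  · exact pos x y h hxy
  · have h1 : psi m x ≤ 0 := by
      have := pos 0 (-x) le_rfl (by linarith)
      rw [psi_zero, psi_neg] at this; linarith
    rcases le_total 0 y with h' | h'
    · have := pos 0 y le_rfl h'
      rw [psi_zero] at this; linarith
    · have := pos (-y) (-x) (by linarith) (by linarith)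
      rw [psi_neg, psi_neg] at this; linarith

lemma psiGap_nonneg {m : ℝ} (hm : 0 < m) (a b : ℝ) : 0 ≤ psiGap m a b := by
  unfold psiGap
  rcases le_total a b with h | h
  · exact mul_nonneg_of_nonpos_of_nonpos (by linarith [psi_monotone hm h]) (by linarith)
  · exact mul_nonneg (by linarith [psi_monotone hm h]) (by linarith)

lemma psiGap_eq_abs {m : ℝ} (hm : 0 < m) (a b : ℝ) :
    psiGap m a b = |psi m a - psi m b| * |a - b| := by
  rw [← abs_mul, ← psiGap, abs_of_nonneg (psiGap_nonneg hm a b)]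

lemma exists_psiGap_bounds {m : ℝ} (hm : 0 < m) : ∃ k K : ℝ, 0 < k ∧ 0 < K ∧ ∀ a b : ℝ,
    k * ((|a| + |a - b|) ^ ((m + 1) / m - 2) * |a - b| ^ 2) ≤ psiGap m a b ∧
      psiGap m a b ≤ K * ((|a| + |a - b|) ^ ((m + 1) / m - 2) * |a - b| ^ 2) := by
  obtain ⟨k, K, hk, hK, H⟩ := exists_psi_sub_bounds hm
  refine ⟨k, K, hk, hK, fun a b => ?_⟩
  have e : (m + 1) / m - 2 = (1 - m) / m := by field_simp; ring
  rw [psiGap_eq_abs hm, e]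
  obtain ⟨p, q⟩ := H a b
  have hn := abs_nonneg (a - b)
  constructor <;> nlinarith

/-- Young's inequality for the monotonicity gap. -/
lemma exists_psi_young {m ε : ℝ} (hm : 0 < m) (hε : 0 < ε) :
    ∃ C : ℝ, 0 < C ∧ ∀ a b c : ℝ,
      |psi m a - psi m b| * |a - c| ≤ ε * psiGap m a b + C * psiGap m a c := by
  obtain ⟨C, hC, H⟩ := exists_psi_sub_le_of_abs_le hm (le_max_left 1 (1 / ε))
  refine ⟨C, hC, fun a b c => ?_⟩
  rcases le_total |a - c| (ε * |a - b|) with h | h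
  · have := mul_le_mul_of_nonneg_left h (abs_nonneg (psi m a - psi m b))
    have h2 := psiGap_nonneg hm a c
    rw [psiGap_eq_abs hm a b]
    nlinarith
  · have h1 : |a - b| ≤ max 1 (1 / ε) * |a - c| := by
      calc |a - b| ≤ 1 / ε * |a - c| := by
            rw [div_mul_eq_mul_div, one_mul, le_div_iff₀ hε]; linarith
        _ ≤ _ := by gcongr; exact le_max_right _ _
    have h2 := mul_le_mul_of_nonneg_right (H a b c h1) (abs_nonneg (a - c))
    have h3 := psiGap_nonneg hm a b
    rw [psiGap_eq_abs hm a c]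
    nlinarith

/-- Quasi-triangle inequality: one of `a`, `b` has distance at least `|a - b| / 2` from `c`, so the
doubling property at that point applies. -/
lemma exists_psiGap_triangle {m : ℝ} (hm : 0 < m) :
    ∃ C : ℝ, 0 < C ∧ ∀ a b c : ℝ, psiGap m a b ≤ C * (psiGap m a c + psiGap m c b) := by
  obtain ⟨C, hC, H⟩ := exists_psi_sub_le_of_abs_le hm one_le_two
  have key : ∀ a b c, |a - b| ≤ 2 * |a - c| → psiGap m a b ≤ C * 2 * psiGap m a c := by
    intro a b c h
    rw [psiGap_eq_abs hm, psiGap_eq_abs hm]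
    calc |psi m a - psi m b| * |a - b| ≤ (C * |psi m a - psi m c|) * (2 * |a - c|) :=
          mul_le_mul (H a b c h) h (abs_nonneg _) (by positivity)
      _ = _ := by ring
  refine ⟨C * 2, by positivity, fun a b c => ?_⟩
  have g1 := psiGap_nonneg hm a c
  have g2 := psiGap_nonneg hm c b
  have C2 : 0 < C * 2 := by positivity
  have t : |a - b| ≤ |a - c| + |c - b| := abs_sub_le a c b
  rcases le_total |c - b| |a - c| with h | h
  · have := key a b c (by linarith)
    nlinarith
  · have := key b a c (by rw [abs_sub_comm b a, abs_sub_comm b c]; linarith)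
    rw [psiGap_comm m b a, psiGap_comm m b c] at this
    nlinarith

/-- The nonlinear estimate behind the error bound: `a`, `b`, `c`, `d` stand for `w(tₙ)`, `Wₙ`,
`w(t)` and `P_h w(t)`. -/
lemma exists_psiGap_absorb {m : ℝ} (hm : 0 < m) :
    ∃ C : ℝ, 0 < C ∧ ∀ a b c d : ℝ,
      psiGap m a b / 2 - (psi m a - psi m b) * (d - b) ≤ C * (psiGap m c a + psiGap m c d) := by
  obtain ⟨C₁, h1, Y1⟩ := exists_psi_young hm (ε := 1 / 4) (by norm_num)
  obtain ⟨C₂, h2, Q⟩ := exists_psiGap_triangle hm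
  obtain ⟨C₃, h3, Y3⟩ := exists_psi_young hm (ε := 1 / (4 * C₂)) (by positivity)
  obtain ⟨C₄, h4, Y4⟩ := exists_psi_young hm one_pos
  refine ⟨C₁ + 1 + 1 + C₃ + C₄, by positivity, fun a b c d => ?_⟩
  have y1 := Y1 a b c
  have y3 := Y3 c b d
  have y4 := Y4 c a d
  have q := Q c b a
  have g1 := psiGap_nonneg hm c a
  have g2 := psiGap_nonneg hm c d
  have g3 := psiGap_nonneg hm a b
  have q' : 1 / (4 * C₂) * psiGap m c b ≤ 1 / 4 * (psiGap m c a + psiGap m a b) := by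
    calc 1 / (4 * C₂) * psiGap m c b
        ≤ 1 / (4 * C₂) * (C₂ * (psiGap m c a + psiGap m a b)) := by gcongr
      _ = _ := by field_simp
  have tri : |psi m a - psi m b| * |c - d| ≤
      |psi m c - psi m a| * |c - d| + |psi m c - psi m b| * |c - d| := by
    rw [← add_mul]
    gcongr
    have := abs_sub_le (psi m a) (psi m c) (psi m b)
    rwa [abs_sub_comm (psi m a) (psi m c)] at this
  have e : psiGap m a b - (psi m a - psi m b) * (d - b) =
      (psi m a - psi m b) * (a - c) + (psi m a - psi m b) * (c - d) := by unfold psiGap; ring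
  have u1 := le_abs_self ((psi m a - psi m b) * (a - c))
  have u2 := le_abs_self ((psi m a - psi m b) * (c - d))
  rw [abs_mul] at u1 u2
  rw [psiGap_comm m a c] at y1
  nlinarith [mul_nonneg h1.le g2, mul_nonneg h3.le g1, mul_nonneg h4.le g1, mul_nonneg h1.le g1]

lemma psi_abs_rpow_mul {m : ℝ} (hm : 0 < m) (y : ℝ) : psi m (|y| ^ (m - 1) * y) = y := by
  rcases eq_or_ne y 0 with rfl | hy
  · simp [psi_zero]
  have hp : 0 < |y| := abs_pos.2 hy
  rw [psi, abs_mul, abs_of_nonneg (Real.rpow_nonneg hp.le _), ← mul_assoc]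
  nth_rewrite 2 [← Real.rpow_one |y|]
  rw [← Real.rpow_add hp, ← Real.rpow_mul hp.le, ← Real.rpow_add hp]
  rw [show (m - 1 + 1) * ((1 - m) / m) + (m - 1) = 0 by field_simp; ring, Real.rpow_zero, one_mul]

lemma psi_psiInv {m : ℝ} (hm : 0 < m) (y : ℝ) : psi m (psiInv m y) = y := psi_abs_rpow_mul hm y

lemma continuous_psi {m : ℝ} (hm : 0 < m) : Continuous (psi m) := by
  have e : psi m = fun y => if 0 ≤ y then y ^ (1 / m) else -(-y) ^ (1 / m) := by
    funext y
    split_ifs with h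
    · exact psi_of_nonneg hm h
    · rw [← psi_of_nonneg hm (by linarith), psi_neg]; ring
  rw [e]
  have h0 : (0 : ℝ) ≤ 1 / m := by positivity
  refine Continuous.if_le ?_ ?_ continuous_const continuous_id ?_
  · exact Real.continuous_rpow_const h0
  · exact ((Real.continuous_rpow_const h0).comp continuous_neg).neg
  · intro x hx
    have hx : 0 = x := hx
    subst hx
    rw [neg_zero, Real.zero_rpow (by positivity), neg_zero]

/-! ### Finite element functions -/

/-- A continuous function on a convex set that is `L`-Lipschitz on each of finitely many closed
sets covering it is `L`-Lipschitz: along a segment the estimate propagates by continuous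
induction. -/
lemma lipschitzOnWith_of_finite_closed_cover {X ι : Type*} [NormedAddCommGroup X]
    [NormedSpace ℝ X] [Finite ι] {f : X → ℝ} {s : Set X} (hs : Convex ℝ s)
    (hf : ContinuousOn f s) {C : ι → Set X} (hC : ∀ i, IsClosed (C i)) (hcov : s ⊆ ⋃ i, C i)
    {L : NNReal} (hL : ∀ i, LipschitzOnWith L f (C i)) : LipschitzOnWith L f s := by
  refine LipschitzOnWith.of_dist_le_mul fun x hx y hy => ?_
  set γ : ℝ → X := fun t => AffineMap.lineMap x y t with hγ
  have γc : Continuous γ := AffineMap.lineMap_continuous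
  have γs : ∀ t ∈ Icc (0 : ℝ) 1, γ t ∈ s := fun t ht => hs.lineMap_mem hx hy ht
  have γd : ∀ a b, dist (γ a) (γ b) = dist a b * dist x y := fun a b => dist_lineMap_lineMap x y a b
  have key : Icc (0 : ℝ) 1 ⊆ {t | dist (f (γ t)) (f x) ≤ L * (t * dist x y)} := by
    apply IsClosed.Icc_subset_of_forall_exists_gt
    · have : IsClosed {t ∈ Icc (0 : ℝ) 1 | dist (f (γ t)) (f x) ≤ L * (t * dist x y)} := by
        refine isClosed_Icc.isClosed_le ?_ (by fun_prop)
        exact (continuous_id.dist continuous_const).comp_continuousOn (hf.comp γc.continuousOn γs)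
      convert this using 1
      ext t; simp [and_comm]
    · simp [γ]
    · rintro t ⟨ht, ht01⟩ z hz
      have hb : t < min z 1 := lt_min hz ht01.2
      -- one of the closed pieces accumulates at `γ t` from the right
      obtain ⟨i, hi⟩ : ∃ i, ∃ᶠ r in 𝓝[>] t, γ r ∈ C i := by
        by_contra hcon
        push Not at hcon
        have h1 := eventually_all.2 hcon
        have h2 : ∀ᶠ r in 𝓝[>] t, r ∈ Ioo t (min z 1) := Ioo_mem_nhdsGT hb
        obtain ⟨r, hr1, hr2⟩ := (h1.and h2).exists
        have hrs := γs r ⟨ht01.1.trans hr2.1.le, (hr2.2.le.trans (min_le_right _ _))⟩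
        obtain ⟨i, hi⟩ := mem_iUnion.1 (hcov hrs)
        exact hr1 i hi
      have hti : γ t ∈ C i := by
        refine (hC i).mem_of_frequently_of_tendsto hi ?_
        exact (γc.tendsto t).mono_left nhdsWithin_le_nhds
      have h2 : ∀ᶠ r in 𝓝[>] t, r ∈ Ioo t (min z 1) := Ioo_mem_nhdsGT hb
      obtain ⟨r, hr1, hr2⟩ := (hi.and_eventually h2).exists
      refine ⟨r, ?_, hr2.1, hr2.2.le.trans (min_le_left _ _)⟩
      have h3 := (hL i).dist_le_mul _ hr1 _ hti
      rw [γd, Real.dist_eq r, abs_of_pos (by linarith [hr2.1])] at h3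
      have h4 := dist_triangle (f (γ r)) (f (γ t)) (f x)
      have h5 : dist (f (γ t)) (f x) ≤ L * (t * dist x y) := ht
      show dist (f (γ r)) (f x) ≤ L * (r * dist x y)
      calc _ ≤ L * ((r - t) * dist x y) + L * (t * dist x y) := by linarith
        _ = _ := by ring
  have := key (right_mem_Icc.2 zero_le_one)
  simpa [γ, dist_comm] using this

/-- Extension by zero across the frontier of an open set preserves the Lipschitz constant. -/
lemma lipschitzWith_of_zero_outside {X : Type*} [NormedAddCommGroup X] [NormedSpace ℝ X]
    {f : X → ℝ} {s : Set X} (hs : IsOpen s) (h0 : ∀ x ∉ s, f x = 0) {L : NNReal}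
    (hL : LipschitzOnWith L f (closure s)) : LipschitzWith L f := by
  have main : ∀ x ∈ s, ∀ y ∉ s, dist (f x) (f y) ≤ L * dist x y := by
    intro x hx y hy
    obtain ⟨z, hzc, hz, hzs⟩ : ∃ z, z ∈ closure s ∧ z ∈ segment ℝ x y ∧ z ∉ s := by
      by_contra! hcon
      exact hy ((convex_segment x y).isPreconnected.subset_of_closure_inter_subset hs
        ⟨x, left_mem_segment ℝ x y, hx⟩ (fun z hz => hcon z hz.1 hz.2)
        (right_mem_segment ℝ x y))
    have h1 := hL.dist_le_mul x (subset_closure hx) z hzc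
    rw [h0 z hzs] at h1
    rw [h0 y hy]
    refine h1.trans ?_
    have := dist_add_dist_of_mem_segment hz
    have := dist_nonneg (x := z) (y := y)
    gcongr
    linarith
  refine LipschitzWith.of_dist_le_mul fun x y => ?_
  by_cases hx : x ∈ s <;> by_cases hy : y ∈ s
  · exact hL.dist_le_mul x (subset_closure hx) y (subset_closure hy)
  · exact main x hx y hy
  · rw [dist_comm, dist_comm x y]; exact main y hy x hx
  · rw [h0 x hx, h0 y hy, dist_self]; positivity

section Domain

variable {N : ℕ} {Ω : Set (EuclideanSpace ℝ (Fin N))}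

lemma IsConvexPolyhedralDomain.isOpen (h : IsConvexPolyhedralDomain Ω) : IsOpen Ω := by
  obtain ⟨-, F, rfl⟩ := h
  exact isOpen_interior

lemma IsConvexPolyhedralDomain.convex (h : IsConvexPolyhedralDomain Ω) : Convex ℝ Ω := by
  obtain ⟨-, F, rfl⟩ := h
  exact (convex_convexHull ℝ _).interior

lemma IsConvexPolyhedralDomain.isBounded (h : IsConvexPolyhedralDomain Ω) :
    Bornology.IsBounded Ω := by
  obtain ⟨-, F, rfl⟩ := h
  exact ((isBounded_convexHull.2 F.finite_toSet.isBounded)).subset interior_subset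

variable {σ : ℝ} {K : Geometry.SimplicialComplex ℝ (EuclideanSpace ℝ (Fin N))}

lemma lipschitzWith_of_mem_femSpace (hΩ : IsConvexPolyhedralDomain Ω) (hK : IsTriangulation Ω σ K)
    {χ : EuclideanSpace ℝ (Fin N) → ℝ} (hχ : χ ∈ femSpace Ω K) :
    ∃ L : NNReal, LipschitzWith L χ := by
  obtain ⟨hc, h0, hA⟩ := hχ
  have : Finite K.faces := hK.finite
  have hA' : ∀ f : K.faces, ∃ L : NNReal,
      LipschitzOnWith L χ (convexHull ℝ (f.1 : Set (EuclideanSpace ℝ (Fin N)))) := by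
    rintro ⟨f, hf⟩
    obtain ⟨A, hA⟩ := hA f hf
    refine ⟨‖LinearMap.toContinuousLinearMap A.linear‖₊,
      LipschitzOnWith.of_dist_le_mul fun x hx y hy => ?_⟩
    rw [hA hx, hA hy, dist_eq_norm, dist_eq_norm, ← vsub_eq_sub, ← vsub_eq_sub,
      ← AffineMap.linearMap_vsub]
    exact (LinearMap.toContinuousLinearMap A.linear).le_opNorm _
  choose L hL using hA'
  have := Fintype.ofFinite K.faces
  refine ⟨∑ i, L i, lipschitzWith_of_zero_outside hΩ.isOpen h0 ?_⟩
  refine lipschitzOnWith_of_finite_closed_cover hΩ.convex.closure hc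
    (C := fun f : K.faces => convexHull ℝ (f.1 : Set (EuclideanSpace ℝ (Fin N))))
    (fun f => (f.1.finite_toSet.isCompact_convexHull (𝕜 := ℝ)).isClosed) ?_ fun i => ?_
  · rw [← hK.space_eq, Geometry.SimplicialComplex.space]
    intro x hx
    simpa using hx
  · exact (hL i).weaken (Finset.single_le_sum (fun _ _ => zero_le) (Finset.mem_univ i))

/-- A finite element function is determined by its values at the vertices. -/
lemma femSpace_eq_of_vertices (hK : IsTriangulation Ω σ K)
    {φ χ : EuclideanSpace ℝ (Fin N) → ℝ} (hφ : φ ∈ femSpace Ω K) (hχ : χ ∈ femSpace Ω K)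
    (h : ∀ a ∈ K.vertices, φ a = χ a) : φ = χ := by
  funext x
  by_cases hx : x ∈ Ω
  · have : x ∈ K.space := by rw [hK.space_eq]; exact subset_closure hx
    obtain ⟨f, hf, hxf⟩ := Geometry.SimplicialComplex.mem_space_iff.1 this
    obtain ⟨A, hA⟩ := hφ.2.2 f hf
    obtain ⟨B, hB⟩ := hχ.2.2 f hf
    have hsub : convexHull ℝ (f : Set (EuclideanSpace ℝ (Fin N))) ⊆ {x | A x = B x} := by
      refine convexHull_min (fun a ha => ?_) ?_
      · have hv : a ∈ K.vertices := by
          rw [Geometry.SimplicialComplex.vertices_eq]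
          exact mem_biUnion hf ha
        have := h a hv
        rwa [hA (subset_convexHull ℝ _ ha), hB (subset_convexHull ℝ _ ha)] at this
      · intro y hy z hz a b _ _ hab
        have hy : A y = B y := hy
        have hz : A z = B z := hz
        show A _ = B _
        rw [Convex.combo_affine_apply hab, Convex.combo_affine_apply hab, hy, hz]
    rw [hA hxf, hB hxf]
    exact hsub hxf
  · rw [hφ.2.1 x hx, hχ.2.1 x hx]

lemma finiteDimensional_femSpace (hK : IsTriangulation Ω σ K) :
    FiniteDimensional ℝ (femSpace Ω K) := by
  have hfin : K.vertices.Finite := by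
    rw [Geometry.SimplicialComplex.vertices_eq]
    exact hK.finite.biUnion fun f _ => f.finite_toSet
  have := hfin.to_subtype
  let ev : femSpace Ω K →ₗ[ℝ] (K.vertices → ℝ) :=
    { toFun := fun φ a => φ.1 a.1
      map_add' := fun _ _ => rfl
      map_smul' := fun _ _ => rfl }
  refine FiniteDimensional.of_injective ev fun φ χ h => ?_
  exact Subtype.ext (femSpace_eq_of_vertices hK φ.2 χ.2 fun a ha => congrFun h ⟨a, ha⟩)

lemma continuous_of_mem_femSpace (hΩ : IsConvexPolyhedralDomain Ω) (hK : IsTriangulation Ω σ K)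
    {χ : EuclideanSpace ℝ (Fin N) → ℝ} (hχ : χ ∈ femSpace Ω K) : Continuous χ :=
  (lipschitzWith_of_mem_femSpace hΩ hK hχ).choose_spec.continuous

lemma hasCompactSupport_of_zero_outside (hb : Bornology.IsBounded Ω)
    {χ : EuclideanSpace ℝ (Fin N) → ℝ} (h0 : ∀ x ∉ Ω, χ x = 0) : HasCompactSupport χ :=
  HasCompactSupport.intro hb.isCompact_closure fun x hx => h0 x fun h => hx (subset_closure h)

lemma exists_bound_of_mem_femSpace (hΩ : IsConvexPolyhedralDomain Ω) (hK : IsTriangulation Ω σ K)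
    {χ : EuclideanSpace ℝ (Fin N) → ℝ} (hχ : χ ∈ femSpace Ω K) : ∃ C, ∀ x, |χ x| ≤ C :=
  (continuous_of_mem_femSpace hΩ hK hχ).bounded_above_of_compact_support
    (hasCompactSupport_of_zero_outside hΩ.isBounded hχ.2.1)

lemma interpolant_mem_femSpace (v : EuclideanSpace ℝ (Fin N) → ℝ) :
    interpolant Ω K v ∈ femSpace Ω K := by
  unfold interpolant
  split_ifs with h
  · exact h.choose_spec.1
  · exact zero_mem _

end Domain

/-! ### The fractional energy form -/

section Energy

variable {N : ℕ} {s : ℝ}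

/-- The weighted difference quotient `(v(x) - v(z)) / |x - z|^{(N+2s)/2}`. The energy form is the
`L²(ℝ^N × ℝ^N)` inner product of such quotients. -/
def fracQuotient (s : ℝ) (v : EuclideanSpace ℝ (Fin N) → ℝ) :
    EuclideanSpace ℝ (Fin N) × EuclideanSpace ℝ (Fin N) → ℝ :=
  fun q => (v q.1 - v q.2) / ‖q.1 - q.2‖ ^ (((N : ℝ) + 2 * s) / 2)

/-- Functions of finite Gagliardo energy: the weighted difference quotient is square integrable. -/
def HasFiniteEnergy (s : ℝ) (v : EuclideanSpace ℝ (Fin N) → ℝ) : Prop :=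
  MemLp (fracQuotient s v) 2 (volume.prod volume)

lemma fracQuotient_mul (v φ : EuclideanSpace ℝ (Fin N) → ℝ)
    (q : EuclideanSpace ℝ (Fin N) × EuclideanSpace ℝ (Fin N)) :
    fracQuotient s v q * fracQuotient s φ q =
      (v q.1 - v q.2) * (φ q.1 - φ q.2) / ‖q.1 - q.2‖ ^ ((N : ℝ) + 2 * s) := by
  have h : ‖q.1 - q.2‖ ^ ((N : ℝ) + 2 * s) = ‖q.1 - q.2‖ ^ (((N : ℝ) + 2 * s) / 2) *
      ‖q.1 - q.2‖ ^ (((N : ℝ) + 2 * s) / 2) := by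
    rw [← pow_two, ← Real.rpow_natCast, ← Real.rpow_mul (norm_nonneg _)]
    congr 1
    push_cast
    ring
  rw [h, fracQuotient, fracQuotient, div_mul_div_comm]

lemma fracQuotient_add (v φ : EuclideanSpace ℝ (Fin N) → ℝ) :
    fracQuotient s (v + φ) = fracQuotient s v + fracQuotient s φ := by
  funext q; simp only [fracQuotient, Pi.add_apply]; ring

lemma fracQuotient_smul (c : ℝ) (v : EuclideanSpace ℝ (Fin N) → ℝ) :
    fracQuotient s (c • v) = c • fracQuotient s v := by
  funext q; simp only [fracQuotient, Pi.smul_apply, smul_eq_mul]; ring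

lemma HasFiniteEnergy.add {v φ : EuclideanSpace ℝ (Fin N) → ℝ} (hv : HasFiniteEnergy s v)
    (hφ : HasFiniteEnergy s φ) : HasFiniteEnergy s (v + φ) := by
  unfold HasFiniteEnergy at *
  rw [fracQuotient_add]
  exact MemLp.add hv hφ

lemma HasFiniteEnergy.smul {v : EuclideanSpace ℝ (Fin N) → ℝ} (hv : HasFiniteEnergy s v) (c : ℝ) :
    HasFiniteEnergy s (c • v) := by
  unfold HasFiniteEnergy at *
  rw [fracQuotient_smul]
  exact hv.const_smul c

lemma HasFiniteEnergy.integrable_mul {v φ : EuclideanSpace ℝ (Fin N) → ℝ}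
    (hv : HasFiniteEnergy s v) (hφ : HasFiniteEnergy s φ) :
    Integrable (fun q => fracQuotient s v q * fracQuotient s φ q) (volume.prod volume) :=
  MemLp.integrable_mul hv hφ

lemma energyForm_eq_integral {v φ : EuclideanSpace ℝ (Fin N) → ℝ} (hv : HasFiniteEnergy s v)
    (hφ : HasFiniteEnergy s φ) : energyForm s v φ =
      ∫ q, fracQuotient s v q * fracQuotient s φ q ∂(volume.prod volume) := by
  rw [integral_prod _ (hv.integrable_mul hφ)]
  simp only [fracQuotient_mul]
  rfl

lemma energyForm_comm (v φ : EuclideanSpace ℝ (Fin N) → ℝ) :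
    energyForm s v φ = energyForm s φ v := by
  unfold energyForm
  simp only [mul_comm]

lemma energyForm_smul_left (c : ℝ) (v φ : EuclideanSpace ℝ (Fin N) → ℝ) :
    energyForm s (c • v) φ = c * energyForm s v φ := by
  unfold energyForm
  rw [← integral_const_mul]
  congr 1; funext x
  rw [← integral_const_mul]
  congr 1; funext z
  simp only [Pi.smul_apply, smul_eq_mul]
  ring

lemma energyForm_smul_right (c : ℝ) (v φ : EuclideanSpace ℝ (Fin N) → ℝ) :
    energyForm s v (c • φ) = c * energyForm s v φ := by
  rw [energyForm_comm, energyForm_smul_left, energyForm_comm]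

lemma energyForm_add_left {v w φ : EuclideanSpace ℝ (Fin N) → ℝ} (hv : HasFiniteEnergy s v)
    (hw : HasFiniteEnergy s w) (hφ : HasFiniteEnergy s φ) :
    energyForm s (v + w) φ = energyForm s v φ + energyForm s w φ := by
  rw [energyForm_eq_integral hv hφ, energyForm_eq_integral hw hφ,
    energyForm_eq_integral (hv.add hw) hφ,
    ← integral_add (hv.integrable_mul hφ) (hw.integrable_mul hφ), fracQuotient_add]
  simp only [Pi.add_apply, add_mul]

lemma energyForm_sub_left {v w φ : EuclideanSpace ℝ (Fin N) → ℝ} (hv : HasFiniteEnergy s v)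
    (hw : HasFiniteEnergy s w) (hφ : HasFiniteEnergy s φ) :
    energyForm s (v - w) φ = energyForm s v φ - energyForm s w φ := by
  have e : v - w = v + (-1 : ℝ) • w := by simp [sub_eq_add_neg]
  rw [e, energyForm_add_left hv (hw.smul _) hφ, energyForm_smul_left]
  ring

lemma aestronglyMeasurable_fracQuotient {v : EuclideanSpace ℝ (Fin N) → ℝ}
    (hv : AEStronglyMeasurable v volume) :
    AEStronglyMeasurable (fracQuotient s v) (volume.prod volume) := by
  refine AEMeasurable.aestronglyMeasurable (AEMeasurable.div ?_ ?_)
  · exact (hv.comp_fst.sub hv.comp_snd).aemeasurable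
  · exact ((measurable_fst.sub measurable_snd).norm.pow_const _).aemeasurable

lemma gagliardoSq_eq_lintegral {v : EuclideanSpace ℝ (Fin N) → ℝ}
    (hv : AEStronglyMeasurable v volume) :
    gagliardoSq s v = ∫⁻ q, ENNReal.ofReal (fracQuotient s v q ^ 2) ∂(volume.prod volume) := by
  rw [lintegral_prod _
    ((aestronglyMeasurable_fracQuotient hv).aemeasurable.pow_const 2).ennreal_ofReal]
  simp only [pow_two, fracQuotient_mul]
  unfold gagliardoSq
  simp only [pow_two]

lemma hasFiniteEnergy_of_gagliardoSq {v : EuclideanSpace ℝ (Fin N) → ℝ}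
    (hv : AEStronglyMeasurable v volume) (h : gagliardoSq s v < ⊤) : HasFiniteEnergy s v := by
  rw [HasFiniteEnergy, memLp_two_iff_integrable_sq (aestronglyMeasurable_fracQuotient hv)]
  refine ⟨(aestronglyMeasurable_fracQuotient hv).pow 2, ?_⟩
  rw [hasFiniteIntegral_iff_ofReal (Eventually.of_forall fun q => sq_nonneg _),
    ← gagliardoSq_eq_lintegral hv]
  exact h

lemma ofReal_energyForm_self {v : EuclideanSpace ℝ (Fin N) → ℝ}
    (hv : AEStronglyMeasurable v volume) (h : HasFiniteEnergy s v) :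
    ENNReal.ofReal (energyForm s v v) = gagliardoSq s v := by
  rw [energyForm_eq_integral h h, gagliardoSq_eq_lintegral hv,
    ofReal_integral_eq_lintegral_ofReal (h.integrable_mul h)
      (Eventually.of_forall fun q => mul_self_nonneg _)]
  simp only [pow_two]

lemma energyForm_self_nonneg (v : EuclideanSpace ℝ (Fin N) → ℝ) : 0 ≤ energyForm s v v :=
  integral_nonneg fun _ => integral_nonneg fun _ =>
    div_nonneg (mul_self_nonneg _) (Real.rpow_nonneg (norm_nonneg _) _)

lemma abs_energyForm_le {v φ : EuclideanSpace ℝ (Fin N) → ℝ} (hv : HasFiniteEnergy s v)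
    (hφ : HasFiniteEnergy s φ) :
    |energyForm s v φ| ≤ energyForm s v v + energyForm s φ φ := by
  rw [energyForm_eq_integral hv hφ, energyForm_eq_integral hv hv, energyForm_eq_integral hφ hφ,
    ← integral_add (hv.integrable_mul hv) (hφ.integrable_mul hφ)]
  refine (abs_integral_le_integral_abs).trans
    (integral_mono (hv.integrable_mul hφ).abs
      ((hv.integrable_mul hv).add (hφ.integrable_mul hφ)) fun q => ?_)
  rw [abs_le]
  constructor <;>
    nlinarith [sq_nonneg (fracQuotient s v q + fracQuotient s φ q),
      sq_nonneg (fracQuotient s v q - fracQuotient s φ q)]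

/-- Integrability of the truncated kernel: near the origin this uses `s < 1`, at infinity
`0 < s`. -/
lemma integrable_min_div_norm_rpow (hN : 1 ≤ N) (hs : s ∈ Ioo (0 : ℝ) 1) {A B : ℝ} (hA : 0 ≤ A)
    (hB : 0 ≤ B) : Integrable (fun y : EuclideanSpace ℝ (Fin N) =>
      min (A * ‖y‖ ^ 2) B / ‖y‖ ^ ((N : ℝ) + 2 * s)) volume := by
  have : Nonempty (Fin N) := ⟨⟨0, hN⟩⟩
  rw [integrable_fun_norm_addHaar (μ := (volume : Measure (EuclideanSpace ℝ (Fin N))))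
    (f := fun r : ℝ => min (A * r ^ 2) B / r ^ ((N : ℝ) + 2 * s)), finrank_euclideanSpace_fin]
  have meas : Measurable fun r : ℝ =>
      r ^ (N - 1) • (min (A * r ^ 2) B / r ^ ((N : ℝ) + 2 * s)) := by
    refine (measurable_id.pow_const _).smul (Measurable.div ?_ (measurable_id.pow_const _))
    exact ((measurable_id.pow_const _).const_mul _).min measurable_const
  have e1 : ∀ r : ℝ, 0 < r → r ^ (N - 1) = r ^ ((N : ℝ) - 1) := fun r hr => by
    rw [← Real.rpow_natCast, Nat.cast_sub hN, Nat.cast_one]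
  rw [← Ioc_union_Ioi_eq_Ioi (zero_le_one (α := ℝ))]
  refine IntegrableOn.union ?_ ?_
  · have h1 : IntegrableOn (fun r : ℝ => A * r ^ (1 - 2 * s)) (Ioc 0 1) volume := by
      rw [← intervalIntegrable_iff_integrableOn_Ioc_of_le zero_le_one]
      exact (intervalIntegral.intervalIntegrable_rpow' (by linarith [hs.2])).const_mul A
    refine Integrable.mono' h1 meas.aestronglyMeasurable ?_
    refine (ae_restrict_iff' measurableSet_Ioc).2 (Eventually.of_forall fun r hr => ?_)
    have hr0 : 0 < r := hr.1
    rw [Real.norm_of_nonneg (by positivity), e1 r hr0, smul_eq_mul]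
    calc r ^ ((N : ℝ) - 1) * (min (A * r ^ 2) B / r ^ ((N : ℝ) + 2 * s))
        ≤ r ^ ((N : ℝ) - 1) * ((A * r ^ 2) / r ^ ((N : ℝ) + 2 * s)) := by
          gcongr; exact min_le_left _ _
      _ = A * (r ^ ((N : ℝ) - 1) * r ^ (2 : ℝ) / r ^ ((N : ℝ) + 2 * s)) := by
          rw [Real.rpow_two]; ring
      _ = A * r ^ (1 - 2 * s) := by
          rw [← Real.rpow_add hr0, ← Real.rpow_sub hr0]; congr 2; ring
  · have h1 : IntegrableOn (fun r : ℝ => B * r ^ (-1 - 2 * s)) (Ioi 1) volume :=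
      (integrableOn_Ioi_rpow_of_lt (by linarith [hs.1]) one_pos).const_mul B
    refine Integrable.mono' h1 meas.aestronglyMeasurable ?_
    refine (ae_restrict_iff' measurableSet_Ioi).2 (Eventually.of_forall fun r hr => ?_)
    have hr0 : 0 < r := lt_trans one_pos hr
    rw [Real.norm_of_nonneg (by positivity), e1 r hr0, smul_eq_mul]
    calc r ^ ((N : ℝ) - 1) * (min (A * r ^ 2) B / r ^ ((N : ℝ) + 2 * s))
        ≤ r ^ ((N : ℝ) - 1) * (B / r ^ ((N : ℝ) + 2 * s)) := by
          gcongr; exact min_le_right _ _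
      _ = B * (r ^ ((N : ℝ) - 1) / r ^ ((N : ℝ) + 2 * s)) := by ring
      _ = B * r ^ (-1 - 2 * s) := by
          rw [← Real.rpow_sub hr0]; congr 2; ring

/-- Bounded Lipschitz functions that vanish outside a bounded set have finite energy. -/
lemma gagliardoSq_lt_top_of_lipschitz (hN : 1 ≤ N) (hs : s ∈ Ioo (0 : ℝ) 1)
    {Ω : Set (EuclideanSpace ℝ (Fin N))} (hb : Bornology.IsBounded Ω) (hm : MeasurableSet Ω)
    {χ : EuclideanSpace ℝ (Fin N) → ℝ} {L : NNReal} (hL : LipschitzWith L χ) {C : ℝ}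
    (hC : ∀ x, |χ x| ≤ C) (h0 : ∀ x ∉ Ω, χ x = 0) : gagliardoSq s χ < ⊤ := by
  set k : EuclideanSpace ℝ (Fin N) → ℝ := fun y =>
    min ((L : ℝ) ^ 2 * ‖y‖ ^ 2) ((2 * C) ^ 2) / ‖y‖ ^ ((N : ℝ) + 2 * s) with hk
  have kn : ∀ y, 0 ≤ k y := fun y =>
    div_nonneg (le_min (by positivity) (by positivity)) (Real.rpow_nonneg (norm_nonneg _) _)
  have ki : Integrable k volume :=
    integrable_min_div_norm_rpow hN hs (by positivity) (by positivity)
  have kfin : ∫⁻ y, ENNReal.ofReal (k y) < ⊤ := by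
    have := ki.hasFiniteIntegral
    rwa [hasFiniteIntegral_iff_ofReal (Eventually.of_forall kn)] at this
  have km : Measurable k := by
    refine Measurable.div ?_ (measurable_norm.pow_const _)
    exact ((measurable_norm.pow_const _).const_mul _).min measurable_const
  set F : EuclideanSpace ℝ (Fin N) → EuclideanSpace ℝ (Fin N) → ENNReal := fun x z =>
    Ω.indicator (fun _ => ENNReal.ofReal (k (x - z))) x with hF
  set G : EuclideanSpace ℝ (Fin N) → EuclideanSpace ℝ (Fin N) → ENNReal := fun x z =>
    Ω.indicator (fun _ => ENNReal.ofReal (k (x - z))) z with hG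
  have kxz : Measurable fun q : EuclideanSpace ℝ (Fin N) × EuclideanSpace ℝ (Fin N) =>
      ENNReal.ofReal (k (q.1 - q.2)) :=
    (km.comp (measurable_fst.sub measurable_snd)).ennreal_ofReal
  have Fm : Measurable (Function.uncurry F) := by
    have : Function.uncurry F = (Prod.fst ⁻¹' Ω).indicator
        fun q => ENNReal.ofReal (k (q.1 - q.2)) := by
      funext q; simp only [Function.uncurry, hF, indicator]; rfl
    rw [this]
    exact kxz.indicator (measurable_fst hm)
  have Gm : Measurable (Function.uncurry G) := by
    have : Function.uncurry G = (Prod.snd ⁻¹' Ω).indicator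
        fun q => ENNReal.ofReal (k (q.1 - q.2)) := by
      funext q; simp only [Function.uncurry, hG, indicator]; rfl
    rw [this]
    exact kxz.indicator (measurable_snd hm)
  have pt : ∀ x z, ENNReal.ofReal ((χ x - χ z) ^ 2 / ‖x - z‖ ^ ((N : ℝ) + 2 * s)) ≤
      F x z + G x z := by
    intro x z
    have main : ENNReal.ofReal ((χ x - χ z) ^ 2 / ‖x - z‖ ^ ((N : ℝ) + 2 * s)) ≤
        ENNReal.ofReal (k (x - z)) := by
      apply ENNReal.ofReal_le_ofReal
      refine div_le_div_of_nonneg_right (le_min ?_ ?_) (Real.rpow_nonneg (norm_nonneg _) _)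
      · have := hL.dist_le_mul x z
        rw [dist_eq_norm, dist_eq_norm] at this
        rw [← mul_pow, ← sq_abs]
        exact pow_le_pow_left₀ (abs_nonneg _) this 2
      · rw [← sq_abs]
        refine pow_le_pow_left₀ (abs_nonneg _) ?_ 2
        have := abs_sub (χ x) (χ z)
        linarith [hC x, hC z]
    by_cases hx : x ∈ Ω
    · simp only [hF, indicator_of_mem hx]
      exact main.trans le_self_add
    by_cases hz : z ∈ Ω
    · simp only [hG, indicator_of_mem hz]
      exact main.trans le_add_self
    · simp [h0 x hx, h0 z hz]
  have Fint : ∫⁻ x, ∫⁻ z, F x z = (∫⁻ y, ENNReal.ofReal (k y)) * volume Ω := by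
    have : ∀ x, ∫⁻ z, F x z = Ω.indicator (fun _ => ∫⁻ y, ENNReal.ofReal (k y)) x := by
      intro x
      by_cases hx : x ∈ Ω
      · simp only [hF, indicator_of_mem hx]
        exact lintegral_sub_left_eq_self (fun y => ENNReal.ofReal (k y)) x
      · simp [hF, indicator_of_notMem hx]
    simp only [this]
    rw [lintegral_indicator hm, setLIntegral_const]
  have Gint : ∫⁻ x, ∫⁻ z, G x z = (∫⁻ y, ENNReal.ofReal (k y)) * volume Ω := by
    rw [lintegral_lintegral_swap Gm.aemeasurable]
    have : ∀ z, ∫⁻ x, G x z = Ω.indicator (fun _ => ∫⁻ y, ENNReal.ofReal (k y)) z := by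
      intro z
      by_cases hz : z ∈ Ω
      · simp only [hG, indicator_of_mem hz]
        exact lintegral_sub_right_eq_self (fun y => ENNReal.ofReal (k y)) z
      · simp [hG, indicator_of_notMem hz]
    simp only [this]
    rw [lintegral_indicator hm, setLIntegral_const]
  have vfin : volume Ω < ⊤ := hb.measure_lt_top
  calc gagliardoSq s χ ≤ ∫⁻ x, ∫⁻ z, (F x z + G x z) :=
        lintegral_mono fun x => lintegral_mono fun z => pt x z
    _ = ∫⁻ x, ((∫⁻ z, F x z) + ∫⁻ z, G x z) := by
        congr 1; funext x
        exact lintegral_add_left (Fm.comp (measurable_prodMk_left (x := x))) _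
    _ = (∫⁻ x, ∫⁻ z, F x z) + ∫⁻ x, ∫⁻ z, G x z :=
        lintegral_add_left (Measurable.lintegral_prod_right (f := F) Fm) _
    _ < ⊤ := by
        rw [Fint, Gint]
        exact ENNReal.add_lt_top.2 ⟨ENNReal.mul_lt_top kfin vfin, ENNReal.mul_lt_top kfin vfin⟩

/-- Fractional Poincaré inequality: integrate the differences against a ball that does not meet
`Ω`. -/
lemma exists_poincare (hN : 1 ≤ N) (hs : 0 < s) {Ω : Set (EuclideanSpace ℝ (Fin N))}
    (hb : Bornology.IsBounded Ω) : ∃ C : ℝ, 0 < C ∧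
      ∀ v : EuclideanSpace ℝ (Fin N) → ℝ, (∀ x ∉ Ω, v x = 0) →
        ∫⁻ x, ENNReal.ofReal (v x ^ 2) ≤ ENNReal.ofReal C * gagliardoSq s v := by
  have : Nonempty (Fin N) := ⟨⟨0, hN⟩⟩
  obtain ⟨R, hR0, hR⟩ := hb.exists_pos_norm_le
  obtain ⟨z₀, hz₀⟩ := exists_norm_eq (EuclideanSpace ℝ (Fin N)) (by linarith : 0 ≤ R + 1)
  set A := Metric.ball z₀ 1 with hA
  have hAΩ : ∀ z ∈ A, z ∉ Ω := by
    intro z hz hzΩ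
    have h1 := hR z hzΩ
    have h2 : ‖z₀ - z‖ < 1 := by rw [← dist_eq_norm, dist_comm]; exact hz
    have h3 := norm_sub_norm_le z₀ z
    linarith
  set ρ := (2 * R + 2) ^ ((N : ℝ) + 2 * s) with hρ
  have ρ0 : 0 < ρ := by positivity
  have hdist : ∀ x ∈ Ω, ∀ z ∈ A, ‖x - z‖ ^ ((N : ℝ) + 2 * s) ≤ ρ := by
    intro x hx z hz
    have h1 := hR x hx
    have h2 : ‖z - z₀‖ < 1 := by rw [← dist_eq_norm]; exact hz
    have h3 : ‖z‖ ≤ R + 2 := by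
      have := norm_le_norm_add_norm_sub' z z₀
      linarith
    have h4 := norm_sub_le x z
    exact Real.rpow_le_rpow (norm_nonneg _) (by linarith) (by positivity)
  have hpos : ∀ x ∈ Ω, ∀ z ∈ A, 0 < ‖x - z‖ ^ ((N : ℝ) + 2 * s) := by
    intro x hx z hz
    refine Real.rpow_pos_of_pos (norm_pos_iff.2 (sub_ne_zero.2 ?_)) _
    rintro rfl
    exact hAΩ x hz hx
  have vA0 : 0 < volume.real A := by
    refine ENNReal.toReal_pos (Metric.measure_ball_pos volume z₀ one_pos).ne'
      measure_ball_lt_top.ne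
  set c := volume.real A / ρ with hc
  have c0 : 0 < c := by positivity
  have inner : ∀ v : EuclideanSpace ℝ (Fin N) → ℝ, (∀ x ∉ Ω, v x = 0) → ∀ x,
      ENNReal.ofReal c * ENNReal.ofReal (v x ^ 2) ≤
        ∫⁻ z, ENNReal.ofReal ((v x - v z) ^ 2 / ‖x - z‖ ^ ((N : ℝ) + 2 * s)) := by
    intro v hv x
    by_cases hx : x ∈ Ω
    · calc ENNReal.ofReal c * ENNReal.ofReal (v x ^ 2)
          = ENNReal.ofReal (v x ^ 2 / ρ) * volume A := by
            rw [← ENNReal.ofReal_mul c0.le, ← ENNReal.ofReal_toReal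
              (measure_ball_lt_top (μ := volume) (x := z₀) (r := 1)).ne,
              ← ENNReal.ofReal_mul (by positivity)]
            congr 1
            rw [hc, Measure.real]; ring
        _ = ∫⁻ z in A, ENNReal.ofReal (v x ^ 2 / ρ) := by rw [setLIntegral_const]
        _ ≤ ∫⁻ z in A, ENNReal.ofReal ((v x - v z) ^ 2 / ‖x - z‖ ^ ((N : ℝ) + 2 * s)) := by
            refine setLIntegral_mono' measurableSet_ball fun z hz => ?_
            rw [hv z (hAΩ z hz), sub_zero]
            exact ENNReal.ofReal_le_ofReal
              (div_le_div_of_nonneg_left (sq_nonneg _) (hpos x hx z hz) (hdist x hx z hz))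
        _ ≤ _ := setLIntegral_le_lintegral _ _
    · simp [hv x hx]
  refine ⟨c⁻¹, inv_pos.2 c0, fun v hv => ?_⟩
  have h := lintegral_mono (μ := volume) (inner v hv)
  rw [lintegral_const_mul' _ _ ENNReal.ofReal_ne_top] at h
  calc ∫⁻ x, ENNReal.ofReal (v x ^ 2)
      = ENNReal.ofReal c⁻¹ * (ENNReal.ofReal c * ∫⁻ x, ENNReal.ofReal (v x ^ 2)) := by
        rw [← mul_assoc, ← ENNReal.ofReal_mul (by positivity), inv_mul_cancel₀ c0.ne']
        simp
    _ ≤ _ := by gcongr; exact h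

end Energy

/-! ### Time-integrated form of the weak equation -/

section Weak

variable {N : ℕ} {Ω : Set (EuclideanSpace ℝ (Fin N))} {s m T : ℝ}
  {u₀ : EuclideanSpace ℝ (Fin N) → ℝ} {u : ℝ → EuclideanSpace ℝ (Fin N) → ℝ}

lemma measurable_abs_rpow_mul (m : ℝ) : Measurable fun y : ℝ => |y| ^ (m - 1) * y :=
  (measurable_id.abs.pow_const _).mul measurable_id

lemma IsWeakSolution.aestronglyMeasurable_wOf (hu : IsWeakSolution Ω s m T u₀ u) :
    AEStronglyMeasurable (fun q : ℝ × EuclideanSpace ℝ (Fin N) => wOf m u q.1 q.2)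
      ((volume.restrict (Icc 0 T)).prod volume) :=
  ((measurable_abs_rpow_mul m).comp_aemeasurable hu.measurable.aemeasurable).aestronglyMeasurable

lemma IsWeakSolution.aestronglyMeasurable_wOf_apply (hu : IsWeakSolution Ω s m T u₀ u) {t : ℝ}
    (ht : t ∈ Icc 0 T) : AEStronglyMeasurable (wOf m u t) volume :=
  ((measurable_abs_rpow_mul m).comp_aemeasurable
    (hu.memLp t ht).aestronglyMeasurable.aemeasurable).aestronglyMeasurable

lemma IsWeakSolution.aestronglyMeasurable_fracQuotient (hu : IsWeakSolution Ω s m T u₀ u) :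
    AEStronglyMeasurable
      (fun p : ℝ × (EuclideanSpace ℝ (Fin N) × EuclideanSpace ℝ (Fin N)) =>
        fracQuotient s (wOf m u p.1) p.2)
      ((volume.restrict (Icc 0 T)).prod (volume.prod volume)) := by
  have h1 : AEStronglyMeasurable
      (fun p : ℝ × (EuclideanSpace ℝ (Fin N) × EuclideanSpace ℝ (Fin N)) => wOf m u p.1 p.2.1)
      ((volume.restrict (Icc 0 T)).prod (volume.prod volume)) :=
    hu.aestronglyMeasurable_wOf.comp_quasiMeasurePreserving
      (f := Prod.map id Prod.fst)
      (QuasiMeasurePreserving.prodMap (Measure.QuasiMeasurePreserving.id _)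
        Measure.quasiMeasurePreserving_fst)
  have h2 : AEStronglyMeasurable
      (fun p : ℝ × (EuclideanSpace ℝ (Fin N) × EuclideanSpace ℝ (Fin N)) => wOf m u p.1 p.2.2)
      ((volume.restrict (Icc 0 T)).prod (volume.prod volume)) :=
    hu.aestronglyMeasurable_wOf.comp_quasiMeasurePreserving
      (f := Prod.map id Prod.snd)
      (QuasiMeasurePreserving.prodMap (Measure.QuasiMeasurePreserving.id _)
        Measure.quasiMeasurePreserving_snd)
  refine AEMeasurable.aestronglyMeasurable (AEMeasurable.div (h1.sub h2).aemeasurable ?_)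
  exact (((measurable_fst.comp measurable_snd).sub
    (measurable_snd.comp measurable_snd)).norm.pow_const _).aemeasurable

lemma restrict_Ioo_le_restrict_Icc (T : ℝ) :
    (volume : Measure ℝ).restrict (Ioo 0 T) ≤ volume.restrict (Icc 0 T) :=
  Measure.restrict_mono Ioo_subset_Icc_self le_rfl

lemma IsWeakSolution.aemeasurable_gagliardoSq (hu : IsWeakSolution Ω s m T u₀ u) :
    AEMeasurable (fun t => gagliardoSq s (wOf m u t)) (volume.restrict (Ioo 0 T)) := by
  have h := (hu.aestronglyMeasurable_fracQuotient.aemeasurable.pow_const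
    2).ennreal_ofReal.lintegral_prod_right'
  refine (h.mono_measure (restrict_Ioo_le_restrict_Icc T)).congr ?_
  refine (ae_restrict_iff' measurableSet_Ioo).2 (Eventually.of_forall fun t ht => ?_)
  exact (gagliardoSq_eq_lintegral
    (hu.aestronglyMeasurable_wOf_apply (Ioo_subset_Icc_self ht))).symm

lemma IsWeakSolution.lintegral_gagliardoSq_lt_top (hu : IsWeakSolution Ω s m T u₀ u) :
    ∫⁻ t in Ioo 0 T, gagliardoSq s (wOf m u t) < ⊤ :=
  lt_of_le_of_lt (lintegral_mono fun _ => le_add_self) hu.energy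

lemma IsWeakSolution.ae_hasFiniteEnergy (hu : IsWeakSolution Ω s m T u₀ u) :
    ∀ᵐ t ∂(volume.restrict (Ioo 0 T)), HasFiniteEnergy s (wOf m u t) := by
  have h := ae_lt_top' hu.aemeasurable_gagliardoSq hu.lintegral_gagliardoSq_lt_top.ne
  filter_upwards [h, ae_restrict_mem measurableSet_Ioo] with t h1 h2
  exact hasFiniteEnergy_of_gagliardoSq
    (hu.aestronglyMeasurable_wOf_apply (Ioo_subset_Icc_self h2)) h1

lemma IsWeakSolution.integrableOn_energyForm (hu : IsWeakSolution Ω s m T u₀ u)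
    {χ : EuclideanSpace ℝ (Fin N) → ℝ} (hχ : HasFiniteEnergy s χ) :
    IntegrableOn (fun t => energyForm s (wOf m u t) χ) (Ioo 0 T) volume := by
  have hm : AEStronglyMeasurable (fun t => energyForm s (wOf m u t) χ)
      (volume.restrict (Ioo 0 T)) := by
    have h := (hu.aestronglyMeasurable_fracQuotient.mul
      (hχ.aestronglyMeasurable.comp_snd
        (μ := (volume : Measure ℝ).restrict (Icc 0 T)))).integral_prod_right'
    refine (h.mono_measure (restrict_Ioo_le_restrict_Icc T)).congr ?_
    filter_upwards [hu.ae_hasFiniteEnergy] with t ht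
    exact (energyForm_eq_integral ht hχ).symm
  have hg : Integrable (fun t => (gagliardoSq s (wOf m u t)).toReal + energyForm s χ χ)
      (volume.restrict (Ioo 0 T)) :=
    (integrable_toReal_of_lintegral_ne_top hu.aemeasurable_gagliardoSq
      hu.lintegral_gagliardoSq_lt_top.ne).add (integrable_const _)
  refine hg.mono' hm ?_
  filter_upwards [hu.ae_hasFiniteEnergy, ae_restrict_mem measurableSet_Ioo] with t h1 h2
  rw [← ofReal_energyForm_self (hu.aestronglyMeasurable_wOf_apply (Ioo_subset_Icc_self h2)) h1,
    ENNReal.toReal_ofReal (energyForm_self_nonneg _)]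
  exact abs_energyForm_le h1 hχ

lemma holderConjugate_exponents (hm : 0 < m) :
    (ENNReal.ofReal (m + 1)).HolderConjugate (ENNReal.ofReal ((m + 1) / m)) := by
  have : (m + 1).HolderConjugate ((m + 1) / m) := by
    rw [Real.holderConjugate_iff]
    exact ⟨by linarith, by field_simp; ring⟩
  exact this.ennrealOfReal

lemma IsWeakSolution.integrable_mul (hu : IsWeakSolution Ω s m T u₀ u) (hm : 0 < m) {t : ℝ}
    (ht : t ∈ Icc 0 T) {χ : EuclideanSpace ℝ (Fin N) → ℝ} (hc : Continuous χ)
    (hs : HasCompactSupport χ) : Integrable (fun x => u t x * χ x) volume := by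
  have := holderConjugate_exponents hm
  exact (hu.memLp t ht).integrable_mul
    (hc.memLp_of_hasCompactSupport (p := ENNReal.ofReal ((m + 1) / m)) hs)

lemma IsWeakSolution.continuousOn_integral_mul (hu : IsWeakSolution Ω s m T u₀ u) (hm : 0 < m)
    {χ : EuclideanSpace ℝ (Fin N) → ℝ} (hc : Continuous χ) (hs : HasCompactSupport χ) :
    ContinuousOn (fun t => ∫ x, u t x * χ x) (Icc 0 T) := by
  intro r hr
  have := holderConjugate_exponents hm
  have hχ : MemLp χ (ENNReal.ofReal ((m + 1) / m)) volume := hc.memLp_of_hasCompactSupport hs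
  refine tendsto_integral_of_L1' _ (hu.integrable_mul hm hr hc hs).aestronglyMeasurable
    (eventually_nhdsWithin_of_forall fun t ht => hu.integrable_mul hm ht hc hs) ?_
  have h1 := ENNReal.Tendsto.mul_const (hu.continuous r hr)
    (Or.inr hχ.eLpNorm_ne_top : (0 : ENNReal) ≠ 0 ∨ eLpNorm χ _ volume ≠ ⊤)
  rw [zero_mul] at h1
  refine tendsto_of_tendsto_of_tendsto_of_le_of_le' tendsto_const_nhds h1
    (Eventually.of_forall fun _ => zero_le) (eventually_nhdsWithin_of_forall fun t ht => ?_)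
  have h2 := eLpNorm_smul_le_mul_eLpNorm (p := ENNReal.ofReal (m + 1))
    (q := ENNReal.ofReal ((m + 1) / m)) (r := 1) hχ.aestronglyMeasurable
    ((hu.memLp t ht).sub (hu.memLp r hr)).aestronglyMeasurable
  refine le_trans (le_of_eq ?_) h2
  congr 1
  funext x
  simp only [Pi.sub_apply, Pi.smul_apply', smul_eq_mul]
  ring

/-- The time cut-off that equals `1` before `r - δ`, decreases linearly to `0` at `r` and vanishes
afterwards. -/
def timeCutoff (r δ t : ℝ) : ℝ := max 0 (min 1 ((r - t) / δ))

lemma timeCutoff_nonneg (r δ t : ℝ) : 0 ≤ timeCutoff r δ t := le_max_left _ _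

lemma timeCutoff_le_one (r δ t : ℝ) : timeCutoff r δ t ≤ 1 :=
  max_le zero_le_one (min_le_left _ _)

lemma timeCutoff_eq_one {r δ t : ℝ} (hδ : 0 < δ) (h : t ≤ r - δ) : timeCutoff r δ t = 1 := by
  have : 1 ≤ (r - t) / δ := by rw [le_div_iff₀ hδ]; linarith
  rw [timeCutoff, min_eq_left this, max_eq_right zero_le_one]

lemma timeCutoff_eq_zero {r δ t : ℝ} (hδ : 0 < δ) (h : r ≤ t) : timeCutoff r δ t = 0 := by
  have : (r - t) / δ ≤ 0 := div_nonpos_of_nonpos_of_nonneg (by linarith) hδ.le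
  rw [timeCutoff, min_eq_right (by linarith), max_eq_left this]

lemma timeCutoff_eq_div {r δ t : ℝ} (hδ : 0 < δ) (h1 : r - δ ≤ t) (h2 : t ≤ r) :
    timeCutoff r δ t = (r - t) / δ := by
  have a : (r - t) / δ ≤ 1 := by rw [div_le_one hδ]; linarith
  have b : 0 ≤ (r - t) / δ := div_nonneg (by linarith) hδ.le
  rw [timeCutoff, min_eq_right a, max_eq_right b]

lemma abs_timeCutoff_sub_le {r δ : ℝ} (hδ : 0 < δ) (a b : ℝ) :
    |timeCutoff r δ a - timeCutoff r δ b| ≤ |a - b| / δ := by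
  unfold timeCutoff
  refine (abs_max_sub_max_le_max _ _ _ _).trans ?_
  rw [sub_self, abs_zero]
  refine max_le (by positivity) ((abs_min_sub_min_le_max _ _ _ _).trans ?_)
  rw [sub_self, abs_zero]
  refine max_le (by positivity) (le_of_eq ?_)
  rw [← sub_div, abs_div, abs_of_pos hδ, show r - a - (r - b) = -(a - b) by ring, abs_neg]

lemma continuous_timeCutoff (r δ : ℝ) : Continuous (timeCutoff r δ) := by
  unfold timeCutoff
  fun_prop

lemma deriv_timeCutoff {r δ t : ℝ} (hδ : 0 < δ) (h1 : t ≠ r - δ) (h2 : t ≠ r) :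
    deriv (timeCutoff r δ) t = (Ioo (r - δ) r).indicator (fun _ => -δ⁻¹) t := by
  rcases lt_or_gt_of_ne h1 with h | h
  · rw [indicator_of_notMem (fun hh => by linarith [hh.1])]
    have : timeCutoff r δ =ᶠ[𝓝 t] fun _ => 1 := by
      filter_upwards [Iio_mem_nhds h] with x hx using timeCutoff_eq_one hδ (le_of_lt hx)
    rw [this.deriv_eq, deriv_const]
  rcases lt_or_gt_of_ne h2 with h' | h'
  · rw [indicator_of_mem (show t ∈ Ioo (r - δ) r from ⟨h, h'⟩)]
    have : timeCutoff r δ =ᶠ[𝓝 t] fun x => (r - x) / δ := by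
      filter_upwards [Ioo_mem_nhds h h'] with x hx using timeCutoff_eq_div hδ hx.1.le hx.2.le
    rw [this.deriv_eq]
    have hd : HasDerivAt (fun x : ℝ => (r - x) / δ) (-1 / δ) t :=
      ((hasDerivAt_id t).const_sub r).div_const δ
    rw [hd.deriv]
    ring
  · rw [indicator_of_notMem (fun hh => by linarith [hh.2])]
    have : timeCutoff r δ =ᶠ[𝓝 t] fun _ => 0 := by
      filter_upwards [Ioi_mem_nhds h'] with x hx using timeCutoff_eq_zero hδ (le_of_lt hx)
    rw [this.deriv_eq, deriv_const]

lemma isTestFunction_timeCutoff_mul {r δ : ℝ} (hδ : 0 < δ) (hr : r ≤ T)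
    {χ : EuclideanSpace ℝ (Fin N) → ℝ} {L : NNReal} (hL : LipschitzWith L χ) {C : ℝ}
    (hC : ∀ x, |χ x| ≤ C) (h0 : ∀ x ∉ Ω, χ x = 0) :
    IsTestFunction Ω T fun t x => timeCutoff r δ t * χ x where
  lipschitz := by
    have hC0 : 0 ≤ C := (abs_nonneg _).trans (hC 0)
    refine ⟨Real.toNNReal (C / δ + L), LipschitzOnWith.of_dist_le_mul fun p _ q _ => ?_⟩
    rw [Real.coe_toNNReal _ (by positivity), Real.dist_eq]
    have e : timeCutoff r δ p.1 * χ p.2 - timeCutoff r δ q.1 * χ q.2 =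
        (timeCutoff r δ p.1 - timeCutoff r δ q.1) * χ p.2 +
          timeCutoff r δ q.1 * (χ p.2 - χ q.2) := by ring
    have d1 : |p.1 - q.1| ≤ dist p q := by rw [← Real.dist_eq]; exact le_max_left _ _
    have d2 : dist p.2 q.2 ≤ dist p q := le_max_right _ _
    have a1 := abs_timeCutoff_sub_le (r := r) hδ p.1 q.1
    have a2 := hL.dist_le_mul p.2 q.2
    rw [Real.dist_eq] at a2
    have a3 : |timeCutoff r δ q.1| ≤ 1 := by
      rw [abs_of_nonneg (timeCutoff_nonneg _ _ _)]; exact timeCutoff_le_one _ _ _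
    rw [e]
    calc _ ≤ |timeCutoff r δ p.1 - timeCutoff r δ q.1| * |χ p.2| +
          |timeCutoff r δ q.1| * |χ p.2 - χ q.2| := by
          rw [← abs_mul, ← abs_mul]; exact abs_add_le _ _
      _ ≤ (dist p q / δ) * C + 1 * (L * dist p q) := by
          gcongr
          · exact a1.trans (by gcongr)
          · exact hC _
          · exact a2.trans (by gcongr)
      _ = _ := by ring
  zero_outside t _ x hx := by simp [h0 x hx]
  final x := by simp [timeCutoff_eq_zero hδ hr]

lemma IsWeakSolution.weak_timeCutoff (hu : IsWeakSolution Ω s m T u₀ u) {r δ : ℝ}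
    (hδ : 0 < δ) (hδr : δ < r) (hr : r ≤ T)
    {χ : EuclideanSpace ℝ (Fin N) → ℝ} {L : NNReal} (hL : LipschitzWith L χ) {C : ℝ}
    (hC : ∀ x, |χ x| ≤ C) (h0 : ∀ x ∉ Ω, χ x = 0) :
    δ⁻¹ * (∫ t in Ioo (r - δ) r, ∫ x, u t x * χ x) +
        ∫ t in Ioo 0 T, timeCutoff r δ t * energyForm s (wOf m u t) χ = ∫ x, u₀ x * χ x := by
  have h := hu.weak _ (isTestFunction_timeCutoff_mul hδ hr hL hC h0)
  have e1 : ∀ t, energyForm s (wOf m u t) (fun x => timeCutoff r δ t * χ x) =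
      timeCutoff r δ t * energyForm s (wOf m u t) χ := fun t => energyForm_smul_right _ _ χ
  have e2 : ∫ t in Ioo 0 T, ∫ x, u t x * deriv (fun r' => timeCutoff r δ r' * χ x) t =
      -(δ⁻¹ * ∫ t in Ioo (r - δ) r, ∫ x, u t x * χ x) := by
    have a : ∀ᵐ t ∂(volume.restrict (Ioo 0 T)),
        ∫ x, u t x * deriv (fun r' => timeCutoff r δ r' * χ x) t =
          (Ioo (r - δ) r).indicator (fun t => -δ⁻¹ * ∫ x, u t x * χ x) t := by
      refine ae_restrict_of_ae ?_
      have n1 : ∀ᵐ t : ℝ, t ≠ r - δ := by simp [ae_iff]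
      have n2 : ∀ᵐ t : ℝ, t ≠ r := by simp [ae_iff]
      filter_upwards [n1, n2] with t h1 h2
      have hd : ∀ x, u t x * deriv (fun r' => timeCutoff r δ r' * χ x) t =
          deriv (timeCutoff r δ) t * (u t x * χ x) := fun x => by
        rw [deriv_mul_const_field]; ring
      simp only [hd]
      rw [integral_const_mul, deriv_timeCutoff hδ h1 h2]
      by_cases ht : t ∈ Ioo (r - δ) r
      · simp [indicator_of_mem ht]
      · simp [indicator_of_notMem ht]
    rw [integral_congr_ae a, setIntegral_indicator measurableSet_Ioo,
      inter_eq_self_of_subset_right (Ioo_subset_Ioo (by linarith) hr), integral_const_mul]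
    ring
  rw [e2, neg_neg] at h
  simp only [e1] at h
  rw [h, timeCutoff_eq_one hδ (by linarith)]
  simp

/-- Letting the time cut-off degenerate to the indicator of `[0, r)`: the weak equation holds in
integrated form at every time, because `u` is continuous in time with values in `L^{m+1}`. -/
lemma IsWeakSolution.integral_eq (hu : IsWeakSolution Ω s m T u₀ u) (hm : 0 < m) {r : ℝ}
    (hr0 : 0 < r) (hr : r ≤ T)
    {χ : EuclideanSpace ℝ (Fin N) → ℝ} {L : NNReal} (hL : LipschitzWith L χ)
    (hcs : HasCompactSupport χ) (h0 : ∀ x ∉ Ω, χ x = 0) (hχ : HasFiniteEnergy s χ) :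
    (∫ x, u r x * χ x) + ∫ t in Ioo 0 r, energyForm s (wOf m u t) χ = ∫ x, u₀ x * χ x := by
  obtain ⟨C, hC⟩ := hL.continuous.bounded_above_of_compact_support hcs
  have hint := hu.integrableOn_energyForm hχ
  have hg := hu.continuousOn_integral_mul hm hL.continuous hcs
  set g : ℝ → ℝ := fun t => ∫ x, u t x * χ x with hgdef
  -- the averages over the degenerating intervals converge to the value at `r`
  have lim1 : Tendsto (fun δ => δ⁻¹ * ∫ t in Ioo (r - δ) r, g t) (𝓝[>] 0) (𝓝 (g r)) := by
    rw [Metric.tendsto_nhdsWithin_nhds]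
    intro ε hε
    obtain ⟨d, hd, H⟩ := Metric.continuousOn_iff.1 hg r ⟨hr0.le, hr⟩ (ε / 2) (half_pos hε)
    refine ⟨min d r, lt_min hd hr0, fun {δ} hδ hδd => ?_⟩
    have hδ : 0 < δ := hδ
    rw [Real.dist_eq, sub_zero, abs_of_pos hδ, lt_min_iff] at hδd
    have sub : Ioo (r - δ) r ⊆ Icc 0 T := fun t ht => ⟨by linarith [ht.1], ht.2.le.trans hr⟩
    have gi : IntegrableOn g (Ioo (r - δ) r) volume :=
      (hg.integrableOn_compact isCompact_Icc).mono_set sub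
    have vol : volume.real (Ioo (r - δ) r) = δ := by
      rw [Real.volume_real_Ioo_of_le (by linarith)]; ring
    have e : δ⁻¹ * (∫ t in Ioo (r - δ) r, g t) - g r =
        δ⁻¹ * ∫ t in Ioo (r - δ) r, (g t - g r) := by
      rw [integral_sub gi (integrableOn_const (by simp)), setIntegral_const, vol, smul_eq_mul]
      field_simp
    rw [Real.dist_eq, e, abs_mul, abs_of_pos (inv_pos.2 hδ)]
    have hb : ‖∫ t in Ioo (r - δ) r, (g t - g r)‖ ≤ ε / 2 * volume.real (Ioo (r - δ) r) := by
      refine norm_setIntegral_le_of_norm_le_const (by simp) fun t ht => ?_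
      have := H t (sub ht) (by
        rw [Real.dist_eq, abs_sub_comm, abs_of_pos (by linarith [ht.2])]
        linarith [ht.1])
      exact this.le
    rw [vol, Real.norm_eq_abs] at hb
    calc δ⁻¹ * _ ≤ δ⁻¹ * (ε / 2 * δ) := by gcongr
      _ = ε / 2 := by field_simp
      _ < ε := by linarith
  have lim2 : Tendsto (fun δ => ∫ t in Ioo 0 T, timeCutoff r δ t * energyForm s (wOf m u t) χ)
      (𝓝[>] 0) (𝓝 (∫ t in Ioo 0 r, energyForm s (wOf m u t) χ)) := by
    have e : ∫ t in Ioo 0 r, energyForm s (wOf m u t) χ =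
        ∫ t in Ioo 0 T, (Iio r).indicator (fun t => energyForm s (wOf m u t) χ) t := by
      rw [setIntegral_indicator measurableSet_Iio]
      congr 2
      ext t
      simp only [mem_Ioo, mem_inter_iff, mem_Iio]
      constructor
      · rintro ⟨a, b⟩; exact ⟨⟨a, b.trans_le hr⟩, b⟩
      · rintro ⟨⟨a, -⟩, b⟩; exact ⟨a, b⟩
    rw [e]
    refine tendsto_integral_filter_of_dominated_convergence
      (fun t => ‖energyForm s (wOf m u t) χ‖)
      (Eventually.of_forall fun δ => (continuous_timeCutoff r δ).aestronglyMeasurable.mul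
        hint.aestronglyMeasurable)
      (Eventually.of_forall fun δ => Eventually.of_forall fun t => ?_) hint.norm
      (Eventually.of_forall fun t => ?_)
    · rw [norm_mul, Real.norm_of_nonneg (timeCutoff_nonneg _ _ _)]
      exact mul_le_of_le_one_left (norm_nonneg _) (timeCutoff_le_one _ _ _)
    · rcases lt_or_ge t r with h | h
      · rw [indicator_of_mem (show t ∈ Iio r from h)]
        refine tendsto_const_nhds.congr' ?_
        filter_upwards [Ioo_mem_nhdsGT (show (0 : ℝ) < r - t by linarith)] with δ hδ
        rw [timeCutoff_eq_one hδ.1 (by linarith [hδ.2]), one_mul]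
      · rw [indicator_of_notMem (show t ∉ Iio r from not_lt.2 h)]
        refine tendsto_const_nhds.congr' ?_
        filter_upwards [self_mem_nhdsWithin] with δ hδ
        rw [timeCutoff_eq_zero hδ h, zero_mul]
  refine tendsto_nhds_unique (lim1.add lim2) (tendsto_const_nhds.congr' ?_)
  filter_upwards [Ioo_mem_nhdsGT hr0] with δ hδ
  exact (hu.weak_timeCutoff hδ.1 hδ.2 hr hL hC h0).symm

lemma IsWeakSolution.integral_increment (hu : IsWeakSolution Ω s m T u₀ u) (hm : 0 < m)
    {r₁ r₂ : ℝ} (h₁ : 0 ≤ r₁) (h₁₂ : r₁ < r₂) (h₂ : r₂ ≤ T)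
    {χ : EuclideanSpace ℝ (Fin N) → ℝ} {L : NNReal} (hL : LipschitzWith L χ)
    (hcs : HasCompactSupport χ) (h0 : ∀ x ∉ Ω, χ x = 0) (hχ : HasFiniteEnergy s χ) :
    (∫ x, u r₂ x * χ x) + ∫ t in Ioo r₁ r₂, energyForm s (wOf m u t) χ = ∫ x, u r₁ x * χ x := by
  have e₂ := hu.integral_eq hm (h₁.trans_lt h₁₂) h₂ hL hcs h0 hχ
  rcases h₁.eq_or_lt with rfl | h₁
  · rw [e₂, hu.initial]
  have e₁ := hu.integral_eq hm h₁ (h₁₂.le.trans h₂) hL hcs h0 hχ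
  have hint := hu.integrableOn_energyForm hχ
  have hsplit : ∫ t in Ioo 0 r₂, energyForm s (wOf m u t) χ =
      (∫ t in Ioo 0 r₁, energyForm s (wOf m u t) χ) +
        ∫ t in Ioo r₁ r₂, energyForm s (wOf m u t) χ := by
    rw [← integral_Ioc_eq_integral_Ioo (x := 0) (y := r₁), ← setIntegral_union
      (Set.disjoint_left.2 fun t ha hb => absurd ha.2 (not_le.2 hb.1)) measurableSet_Ioo
      (hint.mono_set fun t ht => ⟨ht.1, ht.2.trans_lt (h₁₂.trans_le h₂)⟩)
      (hint.mono_set fun t ht => ⟨h₁.trans ht.1, ht.2.trans_le h₂⟩),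
      Ioc_union_Ioo_eq_Ioo h₁.le h₁₂]
  linarith

end Weak

/-! ### The `H^s`-projection and duality on the finite element space -/

section Projection

variable {N : ℕ} {Ω : Set (EuclideanSpace ℝ (Fin N))} {s m T σ : ℝ}
  {K : Geometry.SimplicialComplex ℝ (EuclideanSpace ℝ (Fin N))}

lemma hasFiniteEnergy_of_mem_femSpace (hN : 1 ≤ N) (hs : s ∈ Ioo (0 : ℝ) 1)
    (hΩ : IsConvexPolyhedralDomain Ω) (hK : IsTriangulation Ω σ K)
    {χ : EuclideanSpace ℝ (Fin N) → ℝ} (hχ : χ ∈ femSpace Ω K) : HasFiniteEnergy s χ := by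
  obtain ⟨L, hL⟩ := lipschitzWith_of_mem_femSpace hΩ hK hχ
  obtain ⟨C, hC⟩ := exists_bound_of_mem_femSpace hΩ hK hχ
  exact hasFiniteEnergy_of_gagliardoSq hL.continuous.aestronglyMeasurable
    (gagliardoSq_lt_top_of_lipschitz hN hs hΩ.isBounded hΩ.isOpen.measurableSet hL hC hχ.2.1)

/-- The energy form as a bilinear form on the finite element space. -/
def femEnergy (hfin : ∀ χ ∈ femSpace Ω K, HasFiniteEnergy s χ) :
    LinearMap.BilinForm ℝ (femSpace Ω K) :=
  LinearMap.mk₂ ℝ (fun v φ => energyForm s v.1 φ.1)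
    (fun v w φ => energyForm_add_left (hfin _ v.2) (hfin _ w.2) (hfin _ φ.2))
    (fun c v φ => energyForm_smul_left c v.1 φ.1)
    (fun v φ χ => by
      rw [energyForm_comm, energyForm_comm v.1 φ.1, energyForm_comm v.1 χ.1]
      exact energyForm_add_left (hfin _ φ.2) (hfin _ χ.2) (hfin _ v.2))
    (fun c v φ => energyForm_smul_right c v.1 φ.1)

@[simp]
lemma femEnergy_apply (hfin : ∀ χ ∈ femSpace Ω K, HasFiniteEnergy s χ) (v φ : femSpace Ω K) :
    femEnergy hfin v φ = energyForm s v.1 φ.1 := rfl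

lemma integral_sq_le_energyForm {C : ℝ} (hC : 0 < C)
    (hP : ∀ v : EuclideanSpace ℝ (Fin N) → ℝ, (∀ x ∉ Ω, v x = 0) →
        ∫⁻ x, ENNReal.ofReal (v x ^ 2) ≤ ENNReal.ofReal C * gagliardoSq s v)
    {χ : EuclideanSpace ℝ (Fin N) → ℝ} (hc : Continuous χ) (h0 : ∀ x ∉ Ω, χ x = 0)
    (hχ : HasFiniteEnergy s χ) : ∫ x, χ x ^ 2 ≤ C * energyForm s χ χ := by
  have h := hP χ h0
  rw [← ofReal_energyForm_self hc.aestronglyMeasurable hχ, ← ENNReal.ofReal_mul hC.le] at h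
  rw [integral_eq_lintegral_of_nonneg_ae (Eventually.of_forall fun x => sq_nonneg _)
    (hc.pow 2).aestronglyMeasurable]
  exact ENNReal.toReal_le_of_le_ofReal (mul_nonneg hC.le (energyForm_self_nonneg _)) h

lemma eq_zero_of_energyForm_self (hN : 1 ≤ N) (hs : s ∈ Ioo (0 : ℝ) 1)
    (hΩ : IsConvexPolyhedralDomain Ω) (hK : IsTriangulation Ω σ K)
    {χ : EuclideanSpace ℝ (Fin N) → ℝ} (hχ : χ ∈ femSpace Ω K) (h : energyForm s χ χ = 0) :
    χ = 0 := by
  obtain ⟨C, hC, hP⟩ := exists_poincare hN hs.1 hΩ.isBounded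
  have hc := continuous_of_mem_femSpace hΩ hK hχ
  have hcs := hasCompactSupport_of_zero_outside hΩ.isBounded hχ.2.1
  have h1 := integral_sq_le_energyForm hC hP hc hχ.2.1
    (hasFiniteEnergy_of_mem_femSpace hN hs hΩ hK hχ)
  rw [h, mul_zero] at h1
  have h2 : ∫ x, χ x ^ 2 = 0 := le_antisymm h1 (integral_nonneg fun x => sq_nonneg _)
  have hint : Integrable (fun x => χ x ^ 2) volume :=
    (memLp_two_iff_integrable_sq hc.aestronglyMeasurable).1 (hc.memLp_of_hasCompactSupport hcs)
  rw [integral_eq_zero_iff_of_nonneg (fun x => sq_nonneg _) hint] at h2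
  have h3 := (hc.pow 2).ae_eq_iff_eq volume continuous_const |>.1 h2
  funext x
  exact pow_eq_zero_iff two_ne_zero |>.1 (congrFun h3 x)

/-- Riesz representation of functionals on the finite element space by the energy form. -/
lemma exists_femEnergy_eq (hN : 1 ≤ N) (hs : s ∈ Ioo (0 : ℝ) 1)
    (hΩ : IsConvexPolyhedralDomain Ω) (hK : IsTriangulation Ω σ K)
    (hfin : ∀ χ ∈ femSpace Ω K, HasFiniteEnergy s χ) (ℓ : femSpace Ω K →ₗ[ℝ] ℝ) :
    ∃ F : femSpace Ω K, ∀ χ, femEnergy hfin F χ = ℓ χ := by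
  have := finiteDimensional_femSpace hK
  have hinj : Function.Injective (femEnergy hfin) := by
    rw [← LinearMap.ker_eq_bot, LinearMap.ker_eq_bot']
    intro v hv
    refine Subtype.ext (eq_zero_of_energyForm_self hN hs hΩ hK v.2 ?_)
    rw [← femEnergy_apply hfin, hv, LinearMap.zero_apply]
  have hsurj := (LinearMap.injective_iff_surjective_of_finrank_eq_finrank
    (f := femEnergy hfin) (Subspace.dual_finrank_eq).symm).1 hinj
  obtain ⟨F, hF⟩ := hsurj ℓ
  exact ⟨F, fun χ => by rw [hF]⟩

lemma hsProjection_mem_femSpace (v : EuclideanSpace ℝ (Fin N) → ℝ) :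
    hsProjection Ω s K v ∈ femSpace Ω K := by
  unfold hsProjection
  split_ifs with h
  · exact h.choose_spec.1
  · exact zero_mem _

lemma energyForm_hsProjection (hN : 1 ≤ N) (hs : s ∈ Ioo (0 : ℝ) 1)
    (hΩ : IsConvexPolyhedralDomain Ω) (hK : IsTriangulation Ω σ K)
    {v : EuclideanSpace ℝ (Fin N) → ℝ} (hv : HasFiniteEnergy s v)
    {χ : EuclideanSpace ℝ (Fin N) → ℝ} (hχ : χ ∈ femSpace Ω K) :
    energyForm s (hsProjection Ω s K v) χ = energyForm s v χ := by
  have hfin : ∀ χ ∈ femSpace Ω K, HasFiniteEnergy s χ := fun χ hχ =>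
    hasFiniteEnergy_of_mem_femSpace hN hs hΩ hK hχ
  let ℓ : femSpace Ω K →ₗ[ℝ] ℝ :=
    { toFun := fun φ => energyForm s v φ.1
      map_add' := fun φ χ => by
        rw [energyForm_comm, energyForm_comm v φ.1, energyForm_comm v χ.1]
        exact energyForm_add_left (hfin _ φ.2) (hfin _ χ.2) hv
      map_smul' := fun c φ => energyForm_smul_right c v φ.1 }
  obtain ⟨F, hF⟩ := exists_femEnergy_eq hN hs hΩ hK hfin ℓ
  have hex : ∃ q ∈ femSpace Ω K, ∀ χ ∈ femSpace Ω K,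
      energyForm s (fun x => v x - q x) χ = 0 := by
    refine ⟨F.1, F.2, fun χ hχ => ?_⟩
    have h1 := energyForm_sub_left hv (hfin _ F.2) (hfin _ hχ)
    have h2 : energyForm s F.1 χ = energyForm s v χ := hF ⟨χ, hχ⟩
    rw [h2, sub_self] at h1
    exact h1
  have h : hsProjection Ω s K v = hex.choose := by
    unfold hsProjection
    exact dif_pos hex
  have h1 := energyForm_sub_left hv (hfin _ hex.choose_spec.1) (hfin _ hχ)
  have h2 : energyForm s (v - hex.choose) χ = 0 := hex.choose_spec.2 χ hχ
  rw [h]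
  linarith

/-- The `L²` pairing with a fixed function, as a functional on the finite element space. -/
def femPairing (f : EuclideanSpace ℝ (Fin N) → ℝ)
    (hf : ∀ χ ∈ femSpace Ω K, Integrable (fun x => f x * χ x) volume) :
    femSpace Ω K →ₗ[ℝ] ℝ where
  toFun χ := ∫ x, f x * χ.1 x
  map_add' φ χ := by
    rw [← integral_add (hf _ φ.2) (hf _ χ.2)]
    simp only [Submodule.coe_add, Pi.add_apply, mul_add]
  map_smul' c φ := by
    simp only [Submodule.coe_smul, Pi.smul_apply, smul_eq_mul, RingHom.id_apply]
    rw [← integral_const_mul]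
    congr 1; funext x; ring

@[simp]
lemma femPairing_apply (f : EuclideanSpace ℝ (Fin N) → ℝ)
    (hf : ∀ χ ∈ femSpace Ω K, Integrable (fun x => f x * χ x) volume) (χ : femSpace Ω K) :
    femPairing f hf χ = ∫ x, f x * χ.1 x := rfl

/-- Summation by parts for a sequence of functionals whose increments are represented by a
nonnegative symmetric bilinear form. -/
lemma sum_add_half_le_of_increments {V : Type*} [AddCommGroup V] [Module ℝ V]
    {B : LinearMap.BilinForm ℝ V} (hsymm : ∀ x y, B x y = B y x) (hpos : ∀ x, 0 ≤ B x x)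
    {d : ℕ → V →ₗ[ℝ] ℝ} {x : ℕ → V} {M : ℕ}
    (h : ∀ k < M, ∀ χ, d (k + 1) χ = d k χ - B (x k) χ) :
    ∀ k ≤ M, ∑ j ∈ Finset.range k, d (j + 1) (x j) +
      B (∑ j ∈ Finset.range k, x j) (∑ j ∈ Finset.range k, x j) / 2
        ≤ d 0 (∑ j ∈ Finset.range k, x j) := by
  have tele : ∀ k ≤ M, ∀ χ, d k χ = d 0 χ - B (∑ j ∈ Finset.range k, x j) χ := by
    intro k
    induction k with
    | zero => intro _ χ; simp
    | succ k ih =>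
      intro hk χ
      rw [h k hk χ, ih (by omega) χ, Finset.sum_range_succ, map_add, LinearMap.add_apply]
      ring
  intro k
  induction k with
  | zero => intro _; simp
  | succ k ih =>
    intro hk
    have h1 := ih (by omega)
    have h2 := tele (k + 1) hk (x k)
    have h3 := hpos (x k)
    rw [Finset.sum_range_succ (fun j => d (j + 1) (x j)), h2]
    rw [Finset.sum_range_succ x]
    simp only [map_add, LinearMap.add_apply]
    rw [hsymm (x k) (∑ j ∈ Finset.range k, x j)]
    linarith

end Projection

/-! ### Error estimate on a single time interval -/

section Step

variable {N : ℕ} {Ω : Set (EuclideanSpace ℝ (Fin N))} {s m T σ τ : ℝ} {M : ℕ}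
  {u₀ : EuclideanSpace ℝ (Fin N) → ℝ} {u : ℝ → EuclideanSpace ℝ (Fin N) → ℝ}
  {K : Geometry.SimplicialComplex ℝ (EuclideanSpace ℝ (Fin N))}
  {W : ℕ → EuclideanSpace ℝ (Fin N) → ℝ}

/-- No integrability is needed here: the Bochner integral of a non-integrable function is `0`. -/
lemma ofReal_integral_le_lintegral {X : Type*} [MeasurableSpace X] {μ : Measure X} (f : X → ℝ) :
    ENNReal.ofReal (∫ x, f x ∂μ) ≤ ∫⁻ x, ENNReal.ofReal (f x) ∂μ := by
  by_cases hf : Integrable f μ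
  · calc ENNReal.ofReal (∫ x, f x ∂μ) ≤ ENNReal.ofReal (∫ x, max (f x) 0 ∂μ) :=
          ENNReal.ofReal_le_ofReal (integral_mono hf hf.pos_part fun x => le_max_left _ _)
      _ = ∫⁻ x, ENNReal.ofReal (max (f x) 0) ∂μ :=
          ofReal_integral_eq_lintegral_ofReal hf.pos_part
            (Eventually.of_forall fun x => le_max_right _ _)
      _ = ∫⁻ x, ENNReal.ofReal (f x) ∂μ := by
          congr 1; funext x
          rcases le_total 0 (f x) with h | h
          · rw [max_eq_left h]
          · rw [max_eq_right h, ENNReal.ofReal_of_nonpos h, ENNReal.ofReal_zero]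
  · rw [integral_undef hf]; simp

lemma psi_wOf (hm : 0 < m) (t : ℝ) (x : EuclideanSpace ℝ (Fin N)) :
    psi m (wOf m u t x) = u t x := psi_abs_rpow_mul hm (u t x)

lemma aemeasurable_quasi_integrand {X : Type*} [MeasurableSpace X] (p : ℝ) {μ : Measure X}
    {v₁ v₂ : X → ℝ} (h₁ : AEStronglyMeasurable v₁ μ) (h₂ : AEStronglyMeasurable v₂ μ) :
    AEMeasurable (fun x => ENNReal.ofReal ((|v₁ x| + |v₂ x|) ^ (p - 2) * |v₂ x| ^ 2)) μ := by
  have a₁ : AEMeasurable (fun x => |v₁ x|) μ := h₁.norm.aemeasurable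
  have a₂ : AEMeasurable (fun x => |v₂ x|) μ := h₂.norm.aemeasurable
  exact (((a₁.add a₂).pow_const (p - 2)).mul (a₂.pow_const 2)).ennreal_ofReal

lemma IsWeakSolution.aemeasurable_quasiNormSq (hu : IsWeakSolution Ω s m T u₀ u) (p : ℝ) {r : ℝ}
    (hr : r ∈ Icc 0 T) :
    AEMeasurable (fun t => quasiNormSq Ω p (wOf m u t) (fun x => wOf m u r x - wOf m u t x))
      (volume.restrict (Ioo 0 T)) := by
  have h1 : AEStronglyMeasurable (fun q : ℝ × EuclideanSpace ℝ (Fin N) => wOf m u q.1 q.2)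
      ((volume.restrict (Icc 0 T)).prod (volume.restrict Ω)) :=
    hu.aestronglyMeasurable_wOf.mono_ac
      (Measure.AbsolutelyContinuous.rfl.prod Measure.restrict_le_self.absolutelyContinuous)
  have h2 : AEStronglyMeasurable (fun q : ℝ × EuclideanSpace ℝ (Fin N) => wOf m u r q.2)
      ((volume.restrict (Icc 0 T)).prod (volume.restrict Ω)) :=
    ((hu.aestronglyMeasurable_wOf_apply hr).restrict (s := Ω)).comp_snd
  have h3 : AEMeasurable (fun q : ℝ × EuclideanSpace ℝ (Fin N) =>
      ENNReal.ofReal ((|wOf m u q.1 q.2| + |wOf m u r q.2 - wOf m u q.1 q.2|) ^ (p - 2) *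
        |wOf m u r q.2 - wOf m u q.1 q.2| ^ 2))
      ((volume.restrict (Icc 0 T)).prod (volume.restrict Ω)) :=
    aemeasurable_quasi_integrand p h1 (h2.sub h1)
  unfold quasiNormSq
  exact h3.lintegral_prod_right'.mono_measure (restrict_Ioo_le_restrict_Icc T)

lemma IsWeakSolution.integrable_psiGap (hu : IsWeakSolution Ω s m T u₀ u) (hm : 0 < m) {r : ℝ}
    (hr : r ∈ Icc 0 T) {χ : EuclideanSpace ℝ (Fin N) → ℝ} (hc : Continuous χ)
    (hcs : HasCompactSupport χ) :
    Integrable (fun x => psiGap m (wOf m u r x) (χ x)) volume := by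
  obtain ⟨C, hC, H⟩ := exists_psiGap_triangle hm
  have hw := hu.aestronglyMeasurable_wOf_apply hr
  have hmeas : AEStronglyMeasurable (fun x => psiGap m (wOf m u r x) (χ x)) volume :=
    (((continuous_psi hm).comp_aestronglyMeasurable hw).sub
      ((continuous_psi hm).comp_aestronglyMeasurable hc.aestronglyMeasurable)).mul
      (hw.sub hc.aestronglyMeasurable)
  have i1 : Integrable (fun x => psiGap m (wOf m u r x) 0) volume := by
    have h := (hu.memLp r hr).integrable_norm_rpow (by simpa using by linarith)
      ENNReal.ofReal_ne_top
    rw [ENNReal.toReal_ofReal (by linarith)] at h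
    refine h.congr (Eventually.of_forall fun x => ?_)
    simp only [psiGap, psi_zero, psi_wOf hm, sub_zero, Real.norm_eq_abs]
    rw [wOf]
    rcases eq_or_ne (u r x) 0 with h0 | h0
    · rw [h0, abs_zero, Real.zero_rpow (by linarith)]; simp
    · have hp := abs_pos.2 h0
      rw [show m + 1 = m - 1 + 2 by ring, Real.rpow_add hp, Real.rpow_two, sq_abs]
      ring
  have i2 : Integrable (fun x => psiGap m 0 (χ x)) volume := by
    have hc' : Continuous fun x => psiGap m 0 (χ x) := by
      have := continuous_psi hm
      unfold psiGap
      fun_prop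
    refine hc'.integrable_of_hasCompactSupport (hcs.comp_left (g := psiGap m 0) ?_)
    simp [psiGap]
  refine ((i1.add i2).const_mul C).mono' hmeas (Eventually.of_forall fun x => ?_)
  rw [Real.norm_of_nonneg (psiGap_nonneg hm _ _)]
  exact H _ _ _

/-- The spatial part of the estimate at a fixed time: `a`, `b`, `c`, `d` play the roles of `w(tₙ)`,
`Wₙ`, `w(t)` and `P_h w(t)`. -/
lemma ofReal_gap_sub_pairing_le {p C : ℝ} (hC : 0 ≤ C)
    (hpt : ∀ a b c d : ℝ, psiGap m a b / 2 - (psi m a - psi m b) * (d - b) ≤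
      C * ((|c| + |a - c|) ^ (p - 2) * |a - c| ^ 2 + (|c| + |c - d|) ^ (p - 2) * |c - d| ^ 2))
    {a b c d : EuclideanSpace ℝ (Fin N) → ℝ} (ha : AEStronglyMeasurable a volume)
    (hc : AEStronglyMeasurable c volume)
    (hab : Integrable (fun x => psiGap m (a x) (b x)) volume)
    (hb : Integrable (fun x => (psi m (a x) - psi m (b x)) * b x) volume)
    (hd : Integrable (fun x => (psi m (a x) - psi m (b x)) * d x) volume)
    (h0 : ∀ x ∉ Ω, a x = 0 ∧ b x = 0) :
    ENNReal.ofReal ((∫ x, psiGap m (a x) (b x)) / 2 -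
        ((∫ x, (psi m (a x) - psi m (b x)) * d x) - ∫ x, (psi m (a x) - psi m (b x)) * b x)) ≤
      ENNReal.ofReal C * (quasiNormSq Ω p c (fun x => a x - c x) +
        quasiNormSq Ω p c (fun x => c x - d x)) := by
  have e : (∫ x, psiGap m (a x) (b x)) / 2 -
        ((∫ x, (psi m (a x) - psi m (b x)) * d x) - ∫ x, (psi m (a x) - psi m (b x)) * b x) =
      ∫ x in Ω, (psiGap m (a x) (b x) / 2 - (psi m (a x) - psi m (b x)) * (d x - b x)) := by
    rw [setIntegral_eq_integral_of_forall_compl_eq_zero]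
    · simp only [mul_sub]
      have hdb : Integrable (fun x => (psi m (a x) - psi m (b x)) * d x -
          (psi m (a x) - psi m (b x)) * b x) volume := hd.sub hb
      rw [integral_sub (hab.div_const 2) hdb, integral_sub hd hb, integral_div]
    · intro x hx
      simp [(h0 x hx).1, (h0 x hx).2, psiGap]
  rw [e]
  refine (ofReal_integral_le_lintegral _).trans ?_
  unfold quasiNormSq
  have hmeas : AEMeasurable (fun x => ENNReal.ofReal
      ((|c x| + |a x - c x|) ^ (p - 2) * |a x - c x| ^ 2)) (volume.restrict Ω) :=
    aemeasurable_quasi_integrand p hc.restrict (ha.restrict.sub hc.restrict)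
  rw [← lintegral_add_left' hmeas, ← lintegral_const_mul' _ _ ENNReal.ofReal_ne_top]
  refine lintegral_mono fun x => ?_
  have nn : ∀ y z : ℝ, 0 ≤ (|y| + |z|) ^ (p - 2) * |z| ^ 2 := fun y z =>
    mul_nonneg (Real.rpow_nonneg (by positivity) _) (by positivity)
  rw [← ENNReal.ofReal_add (nn _ _) (nn _ _), ← ENNReal.ofReal_mul hC]
  exact ENNReal.ofReal_le_ofReal (hpt (a x) (b x) (c x) (d x))

lemma quasiNormSq_le_gap_add {p C : ℝ} (hC : 0 ≤ C) (hm : 0 < m)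
    (hpt : ∀ a b c : ℝ, (|c| + |c - b|) ^ (p - 2) * |c - b| ^ 2 ≤
      C * (psiGap m a b + (|c| + |a - c|) ^ (p - 2) * |a - c| ^ 2))
    {a b c : EuclideanSpace ℝ (Fin N) → ℝ}
    (hab : Integrable (fun x => psiGap m (a x) (b x)) volume) :
    quasiNormSq Ω p c (fun x => c x - b x) ≤
      ENNReal.ofReal C * (ENNReal.ofReal (∫ x, psiGap m (a x) (b x)) +
        quasiNormSq Ω p c (fun x => a x - c x)) := by
  have hg : ∫⁻ x in Ω, ENNReal.ofReal (psiGap m (a x) (b x)) ≤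
      ENNReal.ofReal (∫ x, psiGap m (a x) (b x)) := by
    rw [ofReal_integral_eq_lintegral_ofReal hab
      (Eventually.of_forall fun x => psiGap_nonneg hm _ _)]
    exact setLIntegral_le_lintegral _ _
  refine le_trans ?_ (mul_le_mul_right (add_le_add_left hg _) _)
  unfold quasiNormSq
  rw [← lintegral_add_left' hab.aestronglyMeasurable.aemeasurable.ennreal_ofReal.restrict,
    ← lintegral_const_mul' _ _ ENNReal.ofReal_ne_top]
  refine lintegral_mono fun x => ?_
  have nn : ∀ y z : ℝ, 0 ≤ (|y| + |z|) ^ (p - 2) * |z| ^ 2 := fun y z =>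
    mul_nonneg (Real.rpow_nonneg (by positivity) _) (by positivity)
  rw [← ENNReal.ofReal_add (psiGap_nonneg hm _ _) (nn _ _), ← ENNReal.ofReal_mul hC]
  exact ENNReal.ofReal_le_ofReal (hpt (a x) (b x) (c x))

lemma exists_pointwise_error_bounds (hm : 0 < m) : ∃ C₀ C₁ : ℝ, 0 < C₀ ∧ 0 < C₁ ∧
    (∀ a b c d : ℝ, psiGap m a b / 2 - (psi m a - psi m b) * (d - b) ≤
      C₀ * ((|c| + |a - c|) ^ ((m + 1) / m - 2) * |a - c| ^ 2 +
        (|c| + |c - d|) ^ ((m + 1) / m - 2) * |c - d| ^ 2)) ∧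
    ∀ a b c : ℝ, (|c| + |c - b|) ^ ((m + 1) / m - 2) * |c - b| ^ 2 ≤
      C₁ * (psiGap m a b + (|c| + |a - c|) ^ ((m + 1) / m - 2) * |a - c| ^ 2) := by
  obtain ⟨k, κ, hk, hκ, H⟩ := exists_psiGap_bounds hm
  obtain ⟨A, hA, HA⟩ := exists_psiGap_absorb hm
  obtain ⟨B, hB, HB⟩ := exists_psiGap_triangle hm
  refine ⟨A * κ, B * max 1 κ / k, by positivity, by positivity, fun a b c d => ?_,
    fun a b c => ?_⟩
  · refine (HA a b c d).trans ?_
    have h1 := (H c a).2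
    have h2 := (H c d).2
    rw [abs_sub_comm c a] at h1
    calc A * (psiGap m c a + psiGap m c d) ≤ A * (κ * _ + κ * _) := by gcongr
      _ = _ := by ring
  · have h1 := (H c b).1
    have h2 := (H c a).2
    rw [abs_sub_comm c a] at h2
    set q := (|c| + |a - c|) ^ ((m + 1) / m - 2) * |a - c| ^ 2
    have q0 : 0 ≤ q := by positivity
    have g0 := psiGap_nonneg hm a b
    have h3 : psiGap m c b ≤ B * (max 1 κ * (psiGap m a b + q)) := by
      refine (HB c b a).trans ?_
      gcongr
      have := le_max_left 1 κ
      have := le_max_right 1 κ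
      nlinarith
    rw [div_mul_eq_mul_div, le_div_iff₀ hk]
    calc _ = k * ((|c| + |c - b|) ^ ((m + 1) / m - 2) * |c - b| ^ 2) := by ring
      _ ≤ _ := h1.trans h3
      _ = _ := by ring

end Step

/-! ### The error equation -/

section ErrorEquation

variable {N : ℕ} {Ω : Set (EuclideanSpace ℝ (Fin N))} {s m T σ τ : ℝ} {M : ℕ}
  {u₀ w₀ : EuclideanSpace ℝ (Fin N) → ℝ} {u : ℝ → EuclideanSpace ℝ (Fin N) → ℝ}
  {K : Geometry.SimplicialComplex ℝ (EuclideanSpace ℝ (Fin N))}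
  {W : ℕ → EuclideanSpace ℝ (Fin N) → ℝ}

lemma IsDiscreteSolution.psi_initial (hW : IsDiscreteSolution Ω s m K τ M w₀ W) (hm : 0 < m)
    (x : EuclideanSpace ℝ (Fin N)) :
    psi m (W 0 x) = interpolant Ω K (fun y => psi m (w₀ y)) x := by
  rw [hW.initial, psi_psiInv hm]

lemma IsDiscreteSolution.continuous_psi (hW : IsDiscreteSolution Ω s m K τ M w₀ W) (hm : 0 < m)
    (hΩ : IsConvexPolyhedralDomain Ω) (hK : IsTriangulation Ω σ K) {k : ℕ} (hk : k ≤ M) :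
    Continuous fun x => psi m (W k x) := by
  cases k with
  | zero =>
    simp only [hW.psi_initial hm]
    exact continuous_of_mem_femSpace hΩ hK (interpolant_mem_femSpace _)
  | succ k =>
    exact (FracFastDiffusion.continuous_psi hm).comp
      (continuous_of_mem_femSpace hΩ hK (hW.mem k (by omega)))

/-- The error `u(tₖ) - ψ(Wₖ)` can be paired with finite element functions. -/
lemma integrable_error_mul (hu : IsWeakSolution Ω s m T u₀ u)
    (hW : IsDiscreteSolution Ω s m K τ M w₀ W) (hm : 0 < m)
    (hΩ : IsConvexPolyhedralDomain Ω) (hK : IsTriangulation Ω σ K) {k : ℕ} (hk : k ≤ M)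
    (hkT : k * τ ∈ Icc 0 T) :
    ∀ χ ∈ femSpace Ω K, Integrable (fun x => (u (k * τ) x - psi m (W k x)) * χ x) volume := by
  intro χ hχ
  have hc := continuous_of_mem_femSpace hΩ hK hχ
  have hcs := hasCompactSupport_of_zero_outside hΩ.isBounded hχ.2.1
  have h1 := hu.integrable_mul hm hkT hc hcs
  have h2 : Integrable (fun x => psi m (W k x) * χ x) volume :=
    ((hW.continuous_psi hm hΩ hK hk).mul hc).integrable_of_hasCompactSupport hcs.mul_left
  exact (h1.sub h2).congr (Eventually.of_forall fun x => by simp only [Pi.sub_apply]; ring)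

lemma error_increment (hN : 1 ≤ N) (hs : s ∈ Ioo (0 : ℝ) 1) (hu : IsWeakSolution Ω s m T u₀ u)
    (hW : IsDiscreteSolution Ω s m K τ M w₀ W) (hm : 0 < m)
    (hΩ : IsConvexPolyhedralDomain Ω) (hK : IsTriangulation Ω σ K) (hτ : 0 < τ)
    (hMT : M * τ = T) {k : ℕ} (hk : k < M) {χ : EuclideanSpace ℝ (Fin N) → ℝ}
    (hχ : χ ∈ femSpace Ω K) :
    ∫ x, (u ((k + 1 : ℕ) * τ) x - psi m (W (k + 1) x)) * χ x =
      (∫ x, (u (k * τ) x - psi m (W k x)) * χ x) -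
        ((∫ t in Ioo (k * τ) ((k + 1 : ℕ) * τ), energyForm s (wOf m u t) χ) -
          τ * energyForm s (W (k + 1)) χ) := by
  have hc := continuous_of_mem_femSpace hΩ hK hχ
  have hcs := hasCompactSupport_of_zero_outside hΩ.isBounded hχ.2.1
  obtain ⟨L, hL⟩ := lipschitzWith_of_mem_femSpace hΩ hK hχ
  have hk' : ((k + 1 : ℕ) : ℝ) ≤ M := by exact_mod_cast hk
  have t0 : 0 ≤ (k : ℝ) * τ := by positivity
  have t1 : (k : ℝ) * τ < (k + 1 : ℕ) * τ := by
    gcongr; exact Nat.lt_succ_self k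
  have t2 : ((k + 1 : ℕ) : ℝ) * τ ≤ T := by rw [← hMT]; gcongr
  have inc := hu.integral_increment hm t0 t1 t2 hL hcs hχ.2.1
    (hasFiniteEnergy_of_mem_femSpace hN hs hΩ hK hχ)
  have p : ∀ j ≤ M, Integrable (fun x => psi m (W j x) * χ x) volume := fun j hj =>
    ((hW.continuous_psi hm hΩ hK hj).mul hc).integrable_of_hasCompactSupport hcs.mul_left
  have q1 := hu.integrable_mul hm ⟨t0, (t1.le.trans t2)⟩ hc hcs
  have q2 := hu.integrable_mul hm ⟨t0.trans t1.le, t2⟩ hc hcs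
  have deq := hW.eq k hk χ hχ
  rw [setIntegral_eq_integral_of_forall_compl_eq_zero
    (fun x hx => by rw [hχ.2.1 x hx, mul_zero])] at deq
  have e : ∫ x, (psi m (W (k + 1) x) - psi m (W k x)) / τ * χ x =
      ((∫ x, psi m (W (k + 1) x) * χ x) - ∫ x, psi m (W k x) * χ x) / τ := by
    rw [← integral_sub (p _ hk) (p _ hk.le), ← integral_div]
    congr 1; funext x; ring
  rw [e, div_add' _ _ _ hτ.ne', div_eq_zero_iff, or_iff_left hτ.ne'] at deq
  simp only [sub_mul]
  rw [integral_sub q2 (p _ hk), integral_sub q1 (p _ hk.le)]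
  linarith

/-- The time integral of `w` over a subinterval, seen as a functional on the finite element
space through the energy form. -/
def timeIntegralFunctional (hu : IsWeakSolution Ω s m T u₀ u)
    (hfin : ∀ χ ∈ femSpace Ω K, HasFiniteEnergy s χ) (I : Set ℝ) (hI : I ⊆ Ioo 0 T) :
    femSpace Ω K →ₗ[ℝ] ℝ where
  toFun χ := ∫ t in I, energyForm s (wOf m u t) χ.1
  map_add' φ χ := by
    rw [← integral_add ((hu.integrableOn_energyForm (hfin _ φ.2)).mono_set hI)
      ((hu.integrableOn_energyForm (hfin _ χ.2)).mono_set hI)]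
    refine integral_congr_ae ?_
    filter_upwards [ae_restrict_of_ae_restrict_of_subset hI hu.ae_hasFiniteEnergy] with t ht
    rw [energyForm_comm _ φ.1, energyForm_comm _ χ.1, energyForm_comm]
    exact energyForm_add_left (hfin _ φ.2) (hfin _ χ.2) ht
  map_smul' c φ := by
    simp only [Submodule.coe_smul, energyForm_smul_right, smul_eq_mul, RingHom.id_apply]
    exact integral_const_mul _ _

/-- Pairing with a fixed function commutes with the time integral of the projections `P_h w(t)`.
The pairing is represented by the energy form, so measurability in time of `P_h w` is not
needed. -/
lemma pairing_time_integral_hsProjection (hN : 1 ≤ N) (hs : s ∈ Ioo (0 : ℝ) 1)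
    (hΩ : IsConvexPolyhedralDomain Ω) (hK : IsTriangulation Ω σ K)
    (hu : IsWeakSolution Ω s m T u₀ u) {f : EuclideanSpace ℝ (Fin N) → ℝ}
    (hf : ∀ χ ∈ femSpace Ω K, Integrable (fun x => f x * χ x) volume) {I : Set ℝ}
    (hI : I ⊆ Ioo 0 T) {R : EuclideanSpace ℝ (Fin N) → ℝ} (hRm : R ∈ femSpace Ω K)
    (hR : ∀ χ ∈ femSpace Ω K, energyForm s R χ = ∫ t in I, energyForm s (wOf m u t) χ) :
    IntegrableOn (fun t => ∫ x, f x * hsProjection Ω s K (wOf m u t) x) I volume ∧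
      ∫ t in I, ∫ x, f x * hsProjection Ω s K (wOf m u t) x = ∫ x, f x * R x := by
  have hfin : ∀ χ ∈ femSpace Ω K, HasFiniteEnergy s χ := fun χ hχ =>
    hasFiniteEnergy_of_mem_femSpace hN hs hΩ hK hχ
  obtain ⟨F, hF⟩ := exists_femEnergy_eq hN hs hΩ hK hfin (femPairing f hf)
  have hF' : ∀ χ ∈ femSpace Ω K, energyForm s F.1 χ = ∫ x, f x * χ x := fun χ hχ => hF ⟨χ, hχ⟩
  have key : ∀ᵐ t ∂(volume.restrict I), energyForm s (wOf m u t) F.1 =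
      ∫ x, f x * hsProjection Ω s K (wOf m u t) x := by
    filter_upwards [ae_restrict_of_ae_restrict_of_subset hI hu.ae_hasFiniteEnergy] with t ht
    rw [← hF' _ (hsProjection_mem_femSpace _), energyForm_comm F.1,
      energyForm_hsProjection hN hs hΩ hK ht F.2]
  constructor
  · exact (((hu.integrableOn_energyForm (hfin _ F.2)).mono_set hI).congr key)
  · rw [← integral_congr_ae key, ← hR _ F.2, energyForm_comm, hF' _ hRm]

lemma setLIntegral_Ioo_eq_sum (f : ℝ → ENNReal) (hτ : 0 < τ) (M : ℕ) :
    ∫⁻ t in Ioo 0 (M * τ), f t =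
      ∑ k ∈ Finset.range M, ∫⁻ t in Ioo (k * τ) ((k + 1 : ℕ) * τ), f t := by
  induction M with
  | zero => simp
  | succ M ih =>
    have t1 : (M : ℝ) * τ < (M + 1 : ℕ) * τ := by
      gcongr; exact Nat.lt_succ_self M
    have t0 : 0 ≤ (M : ℝ) * τ := by positivity
    rw [Finset.sum_range_succ, ← ih,
      ← setLIntegral_congr (Ioo_ae_eq_Ioc (a := (0 : ℝ)) (b := M * τ)).symm,
      ← lintegral_union measurableSet_Ioo
        (Set.disjoint_left.2 fun t ha hb => absurd ha.2 (not_le.2 hb.1)),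
      Ioc_union_Ioo_eq_Ioo t0 t1]

/-- The error estimate on one time interval `(tₖ, tₖ₊₁)`, up to the pairing of the error with the
increment that enters the error equation. -/
lemma ofReal_step_le {p C : ℝ} (hC : 0 ≤ C) (hN : 1 ≤ N) (hs : s ∈ Ioo (0 : ℝ) 1)
    (hpt : ∀ a b c d : ℝ, psiGap m a b / 2 - (psi m a - psi m b) * (d - b) ≤
      C * ((|c| + |a - c|) ^ (p - 2) * |a - c| ^ 2 + (|c| + |c - d|) ^ (p - 2) * |c - d| ^ 2))
    (hu : IsWeakSolution Ω s m T u₀ u)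
    (hW : IsDiscreteSolution Ω s m K τ M w₀ W) (hm : 0 < m)
    (hΩ : IsConvexPolyhedralDomain Ω) (hK : IsTriangulation Ω σ K) (hτ : 0 < τ)
    (hMT : M * τ = T) {k : ℕ} (hk : k < M) {R : EuclideanSpace ℝ (Fin N) → ℝ}
    (hRm : R ∈ femSpace Ω K)
    (hR : ∀ χ ∈ femSpace Ω K, energyForm s R χ =
      ∫ t in Ioo (k * τ) ((k + 1 : ℕ) * τ), energyForm s (wOf m u t) χ) :
    ENNReal.ofReal (τ * ((∫ x, psiGap m (wOf m u ((k + 1 : ℕ) * τ) x) (W (k + 1) x)) / 2) -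
        ∫ x, (u ((k + 1 : ℕ) * τ) x - psi m (W (k + 1) x)) * (R x - τ * W (k + 1) x)) ≤
      ENNReal.ofReal C *
        ((∫⁻ t in Ioo (k * τ) ((k + 1 : ℕ) * τ), quasiNormSq Ω p (wOf m u t)
            (fun x => wOf m u ((k + 1 : ℕ) * τ) x - wOf m u t x)) +
          ∫⁻ t in Ioo (k * τ) ((k + 1 : ℕ) * τ), quasiNormSq Ω p (wOf m u t)
            (fun x => wOf m u t x - hsProjection Ω s K (wOf m u t) x)) := by
  have hk' : ((k + 1 : ℕ) : ℝ) ≤ M := by exact_mod_cast hk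
  have t0 : 0 ≤ (k : ℝ) * τ := by positivity
  have t1 : (k : ℝ) * τ < (k + 1 : ℕ) * τ := by
    gcongr; exact Nat.lt_succ_self k
  have t2 : ((k + 1 : ℕ) : ℝ) * τ ≤ T := by rw [← hMT]; gcongr
  have hr : ((k + 1 : ℕ) : ℝ) * τ ∈ Icc 0 T := ⟨t0.trans t1.le, t2⟩
  set r : ℝ := ((k + 1 : ℕ) : ℝ) * τ with hrdef
  set I := Ioo (k * τ) r with hIdef
  have hI : I ⊆ Ioo 0 T := Ioo_subset_Ioo t0 t2
  have hWm := hW.mem k hk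
  have hWc := continuous_of_mem_femSpace hΩ hK hWm
  have hWcs := hasCompactSupport_of_zero_outside hΩ.isBounded hWm.2.1
  have hf := integrable_error_mul hu hW hm hΩ hK hk hr
  rw [← hrdef] at hf
  obtain ⟨hPint, hPeq⟩ := pairing_time_integral_hsProjection hN hs hΩ hK hu hf hI hRm hR
  set g := ∫ x, psiGap m (wOf m u r x) (W (k + 1) x) with hg
  set dW := ∫ x, (u r x - psi m (W (k + 1) x)) * W (k + 1) x with hdW
  have hvol : volume.real I = τ := by
    rw [Real.volume_real_Ioo_of_le t1.le, hrdef]; push_cast; ring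
  have e1 : ∫ x, (u r x - psi m (W (k + 1) x)) * (R x - τ * W (k + 1) x) =
      (∫ x, (u r x - psi m (W (k + 1) x)) * R x) - τ * dW := by
    rw [hdW, ← integral_const_mul, ← integral_sub (hf _ hRm) ((hf _ hWm).const_mul τ)]
    congr 1; funext x; ring
  have ci : ∀ a : ℝ, IntegrableOn (fun _ : ℝ => a) I volume := fun a =>
    integrableOn_const (by simp [hIdef])
  have e2 : τ * (g / 2) - ((∫ x, (u r x - psi m (W (k + 1) x)) * R x) - τ * dW) =
      ∫ t in I, (g / 2 - ((∫ x, (u r x - psi m (W (k + 1) x)) *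
        hsProjection Ω s K (wOf m u t) x) - dW)) := by
    have hPd : IntegrableOn (fun t => (∫ x, (u r x - psi m (W (k + 1) x)) *
        hsProjection Ω s K (wOf m u t) x) - dW) I volume := hPint.sub (ci dW)
    rw [integral_sub (ci _) hPd, integral_sub hPint (ci dW), setIntegral_const,
      setIntegral_const, hPeq, hvol, smul_eq_mul, smul_eq_mul]
  rw [e1, e2]
  refine (ofReal_integral_le_lintegral _).trans ?_
  rw [← lintegral_add_left' ((hu.aemeasurable_quasiNormSq p hr).mono_measure
    (Measure.restrict_mono hI le_rfl)), ← lintegral_const_mul' _ _ ENNReal.ofReal_ne_top]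
  refine setLIntegral_mono' measurableSet_Ioo fun t ht => ?_
  have htT : t ∈ Icc 0 T := Ioo_subset_Icc_self (hI ht)
  have hPm : hsProjection Ω s K (wOf m u t) ∈ femSpace Ω K := hsProjection_mem_femSpace _
  have h := ofReal_gap_sub_pairing_le (a := wOf m u r) (b := W (k + 1)) (c := wOf m u t)
    (d := hsProjection Ω s K (wOf m u t)) hC hpt
    (hu.aestronglyMeasurable_wOf_apply hr) (hu.aestronglyMeasurable_wOf_apply htT)
    (hu.integrable_psiGap hm hr hWc hWcs)
    (by simp only [psi_wOf hm]; exact hf _ hWm)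
    (by simp only [psi_wOf hm]; exact hf _ hPm)
    (fun x hx => ⟨by simp [wOf, hu.zero_outside r hr x hx], hWm.2.1 x hx⟩)
  simp only [psi_wOf hm] at h
  exact h

end ErrorEquation

/-! ### Summation over the time steps -/

section Summation

variable {N : ℕ} {Ω : Set (EuclideanSpace ℝ (Fin N))} {s m T σ τ : ℝ} {M : ℕ}
  {u₀ w₀ : EuclideanSpace ℝ (Fin N) → ℝ} {u : ℝ → EuclideanSpace ℝ (Fin N) → ℝ}
  {K : Geometry.SimplicialComplex ℝ (EuclideanSpace ℝ (Fin N))}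
  {W : ℕ → EuclideanSpace ℝ (Fin N) → ℝ}

/-- Young's inequality and the Poincaré inequality for the pairing with the initial error. -/
lemma integral_mul_le_of_poincare {C : ℝ} (hC : 0 < C)
    {f χ : EuclideanSpace ℝ (Fin N) → ℝ} (hf : MemLp f 2 volume) (hχ : MemLp χ 2 volume)
    (h : ∫ x, χ x ^ 2 ≤ C * energyForm s χ χ) :
    ∫ x, f x * χ x ≤ C / 2 * (∫ x, f x ^ 2) + energyForm s χ χ / 2 := by
  have i1 := hf.integrable_sq
  have i2 := hχ.integrable_sq
  have h1 : ∫ x, f x * χ x ≤ ∫ x, (C / 2 * f x ^ 2 + 1 / (2 * C) * χ x ^ 2) := by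
    refine integral_mono (hf.integrable_mul hχ) ((i1.const_mul _).add (i2.const_mul _))
      fun x => ?_
    have : 0 ≤ (C * f x - χ x) ^ 2 / (2 * C) := by positivity
    have e : (C * f x - χ x) ^ 2 / (2 * C) =
        C / 2 * f x ^ 2 + 1 / (2 * C) * χ x ^ 2 - f x * χ x := by field_simp; ring
    linarith
  rw [integral_add (i1.const_mul _) (i2.const_mul _), integral_const_mul,
    integral_const_mul] at h1
  have h2 : 1 / (2 * C) * ∫ x, χ x ^ 2 ≤ energyForm s χ χ / 2 := by
    calc _ ≤ 1 / (2 * C) * (C * energyForm s χ χ) := by gcongr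
      _ = _ := by field_simp
  linarith

lemma memLp_two_of_memLp_top (hb : Bornology.IsBounded Ω) (hm : MeasurableSet Ω)
    {f : EuclideanSpace ℝ (Fin N) → ℝ} (hf : MemLp f ⊤ volume) (h0 : ∀ x ∉ Ω, f x = 0) :
    MemLp f 2 volume := by
  have : IsFiniteMeasure ((volume : Measure (EuclideanSpace ℝ (Fin N))).restrict Ω) :=
    isFiniteMeasure_restrict.2 hb.measure_lt_top.ne
  have e : f = Ω.indicator f := by
    funext x
    by_cases hx : x ∈ Ω
    · rw [indicator_of_mem hx]
    · rw [indicator_of_notMem hx, h0 x hx]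
  rw [e, memLp_indicator_iff_restrict hm]
  exact (hf.restrict Ω).mono_exponent le_top

lemma ofReal_integral_sq_le_eLpNorm (f : EuclideanSpace ℝ (Fin N) → ℝ) :
    ENNReal.ofReal (∫ x, f x ^ 2) ≤ eLpNorm f 2 volume ^ 2 := by
  refine (ofReal_integral_le_lintegral _).trans (le_of_eq ?_)
  have h := eLpNorm_nnreal_pow_eq_lintegral (f := f) (μ := volume) (p := 2) two_ne_zero
  simp only [NNReal.coe_ofNat, ENNReal.coe_ofNat, ENNReal.rpow_ofNat] at h
  rw [h]
  refine lintegral_congr fun x => ?_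
  rw [← enorm_pow, Real.enorm_eq_ofReal (sq_nonneg _)]

lemma stepInTime_eq (hτ : 0 < τ) {k : ℕ} {t : ℝ} (ht : t ∈ Ioo (k * τ) ((k + 1 : ℕ) * τ)) :
    stepInTime τ W t = W (k + 1) := by
  unfold stepInTime
  congr 1
  rw [Nat.ceil_eq_iff (Nat.succ_ne_zero k), lt_div_iff₀ hτ, div_le_iff₀ hτ]
  exact ⟨ht.1, ht.2.le⟩

/-- The monotonicity gaps at the discrete times are controlled by the three error terms. -/
lemma ofReal_sum_gap_le {p C C_P : ℝ} (hC : 0 ≤ C) (hC_P : 0 < C_P) (hN : 1 ≤ N)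
    (hs : s ∈ Ioo (0 : ℝ) 1)
    (hP : ∀ v : EuclideanSpace ℝ (Fin N) → ℝ, (∀ x ∉ Ω, v x = 0) →
        ∫⁻ x, ENNReal.ofReal (v x ^ 2) ≤ ENNReal.ofReal C_P * gagliardoSq s v)
    (hpt : ∀ a b c d : ℝ, psiGap m a b / 2 - (psi m a - psi m b) * (d - b) ≤
      C * ((|c| + |a - c|) ^ (p - 2) * |a - c| ^ 2 + (|c| + |c - d|) ^ (p - 2) * |c - d| ^ 2))
    (hu₀ : MemLp u₀ ⊤ volume) (hu₀_zero : ∀ x ∉ Ω, u₀ x = 0)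
    (hu : IsWeakSolution Ω s m T u₀ u)
    (hW : IsDiscreteSolution Ω s m K τ M (wOf m u 0) W) (hm : 0 < m)
    (hΩ : IsConvexPolyhedralDomain Ω) (hK : IsTriangulation Ω σ K) (hτ : 0 < τ)
    (hMT : M * τ = T) :
    ENNReal.ofReal (∑ k ∈ Finset.range M,
        τ * ((∫ x, psiGap m (wOf m u ((k + 1 : ℕ) * τ) x) (W (k + 1) x)) / 2)) ≤
      ENNReal.ofReal C *
        ((∑ k ∈ Finset.range M, ∫⁻ t in Ioo (k * τ) ((k + 1 : ℕ) * τ),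
            quasiNormSq Ω p (wOf m u t)
              (fun x => wOf m u ((k + 1 : ℕ) * τ) x - wOf m u t x)) +
          ∫⁻ t in Ioo 0 T, quasiNormSq Ω p (wOf m u t)
            (fun x => wOf m u t x - hsProjection Ω s K (wOf m u t) x)) +
      ENNReal.ofReal (C_P / 2) * eLpNorm (fun x => psi m (wOf m u 0 x) -
        interpolant Ω K (fun y => psi m (wOf m u 0 y)) x) 2 volume ^ 2 := by
  have hfin : ∀ χ ∈ femSpace Ω K, HasFiniteEnergy s χ := fun χ hχ =>
    hasFiniteEnergy_of_mem_femSpace hN hs hΩ hK hχ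
  have hkT : ∀ k ≤ M, (k : ℝ) * τ ∈ Icc 0 T := fun k hk => by
    have : (k : ℝ) ≤ M := by exact_mod_cast hk
    exact ⟨by positivity, by rw [← hMT]; gcongr⟩
  have hI : ∀ k < M, Ioo (k * τ) ((k + 1 : ℕ) * τ) ⊆ Ioo 0 T := fun k hk =>
    Ioo_subset_Ioo (hkT k hk.le).1 (hkT (k + 1) hk).2
  have hf : ∀ k ≤ M, ∀ χ ∈ femSpace Ω K,
      Integrable (fun x => (u (k * τ) x - psi m (W k x)) * χ x) volume := fun k hk =>
    integrable_error_mul hu hW hm hΩ hK hk (hkT k hk)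
  have hRex : ∀ k, ∃ R : femSpace Ω K, k < M → ∀ χ ∈ femSpace Ω K, energyForm s R.1 χ =
      ∫ t in Ioo (k * τ) ((k + 1 : ℕ) * τ), energyForm s (wOf m u t) χ := by
    intro k
    by_cases hk : k < M
    · obtain ⟨R, hR⟩ := exists_femEnergy_eq hN hs hΩ hK hfin
        (timeIntegralFunctional hu hfin _ (hI k hk))
      exact ⟨R, fun _ χ hχ => hR ⟨χ, hχ⟩⟩
    · exact ⟨0, fun h => absurd h hk⟩
  choose R hR using hRex
  set V : ℕ → femSpace Ω K := fun k => if hk : k < M then ⟨W (k + 1), hW.mem k hk⟩ else 0 with hV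
  have hVW : ∀ k < M, (V k).1 = W (k + 1) := fun k hk => by simp only [hV, dif_pos hk]
  set d : ℕ → femSpace Ω K →ₗ[ℝ] ℝ := fun k => if hk : k ≤ M then
    femPairing (fun x => u (k * τ) x - psi m (W k x)) (hf k hk) else 0 with hd
  have hdk : ∀ k ≤ M, ∀ χ, d k χ = ∫ x, (u (k * τ) x - psi m (W k x)) * χ.1 x :=
    fun k hk χ => by simp only [hd, dif_pos hk, femPairing_apply]
  set x : ℕ → femSpace Ω K := fun k => R k - τ • V k with hx
  have hinc : ∀ k < M, ∀ χ, d (k + 1) χ = d k χ - femEnergy hfin (x k) χ := by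
    intro k hk χ
    rw [hdk _ hk, hdk _ hk.le, error_increment hN hs hu hW hm hΩ hK hτ hMT hk χ.2]
    simp only [hx, map_sub, map_smul, LinearMap.sub_apply, LinearMap.smul_apply,
      femEnergy_apply, smul_eq_mul]
    rw [hR k hk χ.1 χ.2, hVW k hk]
  have hsum := sum_add_half_le_of_increments (B := femEnergy hfin)
    (fun v φ => energyForm_comm _ _) (fun v => energyForm_self_nonneg _) hinc M le_rfl
  set X : femSpace Ω K := ∑ j ∈ Finset.range M, x j with hX
  have hXc := continuous_of_mem_femSpace hΩ hK X.2
  have hXcs := hasCompactSupport_of_zero_outside hΩ.isBounded X.2.2.1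
  set f₀ : EuclideanSpace ℝ (Fin N) → ℝ := fun x => psi m (wOf m u 0 x) -
    interpolant Ω K (fun y => psi m (wOf m u 0 y)) x with hf₀
  have hd0 : d 0 X = ∫ x, f₀ x * X.1 x := by
    rw [hdk 0 (Nat.zero_le _)]
    simp only [hf₀, hW.psi_initial hm, psi_wOf hm, Nat.cast_zero, zero_mul]
  have hf₀L : MemLp f₀ 2 volume := by
    have hi : interpolant Ω K (fun y => psi m (wOf m u 0 y)) ∈ femSpace Ω K :=
      interpolant_mem_femSpace _
    have h1 : MemLp (fun x => psi m (wOf m u 0 x)) 2 volume := by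
      simp only [psi_wOf hm, hu.initial]
      exact memLp_two_of_memLp_top hΩ.isBounded hΩ.isOpen.measurableSet hu₀ hu₀_zero
    exact h1.sub ((continuous_of_mem_femSpace hΩ hK hi).memLp_of_hasCompactSupport
      (hasCompactSupport_of_zero_outside hΩ.isBounded hi.2.1))
  have hyoung := integral_mul_le_of_poincare hC_P hf₀L (hXc.memLp_of_hasCompactSupport hXcs)
    (integral_sq_le_energyForm hC_P hP hXc X.2.2.1 (hfin _ X.2))
  have hD : ∑ j ∈ Finset.range M, d (j + 1) (x j) ≤ C_P / 2 * ∫ x, f₀ x ^ 2 := by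
    rw [hd0, femEnergy_apply] at hsum
    linarith
  have hDx : ∀ k < M, d (k + 1) (x k) = ∫ y, (u ((k + 1 : ℕ) * τ) y - psi m (W (k + 1) y)) *
      ((R k).1 y - τ * W (k + 1) y) := by
    intro k hk
    rw [hdk _ hk, ← hVW k hk]
    rfl
  calc _ = ENNReal.ofReal ((∑ k ∈ Finset.range M, (τ * ((∫ y, psiGap m
          (wOf m u ((k + 1 : ℕ) * τ) y) (W (k + 1) y)) / 2) - d (k + 1) (x k))) +
          ∑ k ∈ Finset.range M, d (k + 1) (x k)) := by
        rw [← Finset.sum_add_distrib]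
        simp only [sub_add_cancel]
    _ ≤ (∑ k ∈ Finset.range M, ENNReal.ofReal (τ * ((∫ y, psiGap m
          (wOf m u ((k + 1 : ℕ) * τ) y) (W (k + 1) y)) / 2) - d (k + 1) (x k))) +
          ENNReal.ofReal (C_P / 2 * ∫ x, f₀ x ^ 2) := by
        refine ENNReal.ofReal_add_le.trans (add_le_add ?_ (ENNReal.ofReal_le_ofReal hD))
        exact Finset.le_sum_of_subadditive ENNReal.ofReal ENNReal.ofReal_zero.le
          (fun _ _ => ENNReal.ofReal_add_le) _ _
    _ ≤ _ := by
        refine add_le_add ?_ ?_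
        · rw [← hMT, setLIntegral_Ioo_eq_sum _ hτ, ← Finset.sum_add_distrib, Finset.mul_sum]
          refine Finset.sum_le_sum fun k hk => ?_
          have hk := Finset.mem_range.1 hk
          rw [hDx k hk]
          exact ofReal_step_le hC hN hs hpt hu hW hm hΩ hK hτ hMT hk (R k).2 (hR k hk)
        · rw [ENNReal.ofReal_mul (by positivity)]
          gcongr
          exact ofReal_integral_sq_le_eLpNorm f₀

lemma setLIntegral_quasiNormSq_stepInTime_le {p C : ℝ} (hC : 0 ≤ C)
    (hpt : ∀ a b c : ℝ, (|c| + |c - b|) ^ (p - 2) * |c - b| ^ 2 ≤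
      C * (psiGap m a b + (|c| + |a - c|) ^ (p - 2) * |a - c| ^ 2))
    (hu : IsWeakSolution Ω s m T u₀ u)
    (hW : IsDiscreteSolution Ω s m K τ M w₀ W) (hm : 0 < m)
    (hΩ : IsConvexPolyhedralDomain Ω) (hK : IsTriangulation Ω σ K) (hτ : 0 < τ)
    (hMT : M * τ = T) {k : ℕ} (hk : k < M) :
    ∫⁻ t in Ioo (k * τ) ((k + 1 : ℕ) * τ),
        quasiNormSq Ω p (wOf m u t) (fun x => wOf m u t x - stepInTime τ W t x) ≤
      ENNReal.ofReal C * (2 * ENNReal.ofReal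
          (τ * ((∫ x, psiGap m (wOf m u ((k + 1 : ℕ) * τ) x) (W (k + 1) x)) / 2)) +
        ∫⁻ t in Ioo (k * τ) ((k + 1 : ℕ) * τ), quasiNormSq Ω p (wOf m u t)
          (fun x => wOf m u ((k + 1 : ℕ) * τ) x - wOf m u t x)) := by
  have hk' : ((k + 1 : ℕ) : ℝ) ≤ M := by exact_mod_cast hk
  have hr : ((k + 1 : ℕ) : ℝ) * τ ∈ Icc 0 T := ⟨by positivity, by rw [← hMT]; gcongr⟩
  have hWc := continuous_of_mem_femSpace hΩ hK (hW.mem k hk)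
  have hWcs := hasCompactSupport_of_zero_outside hΩ.isBounded (hW.mem k hk).2.1
  have hgap := hu.integrable_psiGap hm hr hWc hWcs
  set g := ∫ x, psiGap m (wOf m u ((k + 1 : ℕ) * τ) x) (W (k + 1) x) with hg
  have e : 2 * ENNReal.ofReal (τ * (g / 2)) =
      ∫⁻ t in Ioo (k * τ) ((k + 1 : ℕ) * τ), ENNReal.ofReal g := by
    have hvol : ((k + 1 : ℕ) : ℝ) * τ - k * τ = τ := by push_cast; ring
    rw [setLIntegral_const, Real.volume_Ioo, hvol, ← ENNReal.ofReal_mul' hτ.le,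
      ← ENNReal.ofReal_ofNat 2, ← ENNReal.ofReal_mul (by norm_num)]
    congr 1; ring
  rw [e, ← lintegral_add_left measurable_const, ← lintegral_const_mul' _ _ ENNReal.ofReal_ne_top]
  refine setLIntegral_mono' measurableSet_Ioo fun t ht => ?_
  rw [stepInTime_eq hτ ht]
  exact quasiNormSq_le_gap_add hC hm hpt hgap

lemma sum_Icc_one_eq_sum_range {β : Type*} [AddCommMonoid β] (f : ℕ → β) (M : ℕ) :
    ∑ n ∈ Finset.Icc 1 M, f n = ∑ k ∈ Finset.range M, f (k + 1) := by
  rw [Finset.range_eq_Ico, Finset.sum_Ico_add' f 0 M 1]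
  rfl

end Summation

end FracFastDiffusion

end

open FracFastDiffusion in
theorem corollary3p2 (N : ℕ) (hN : 1 ≤ N) (Ω : Set (EuclideanSpace ℝ (Fin N)))
    (hΩ : IsConvexPolyhedralDomain Ω) (s : ℝ) (hs : s ∈ Set.Ioo (0 : ℝ) 1) (m : ℝ) (hm : 0 < m)
    (T : ℝ) (hT : 0 < T) (u₀ : EuclideanSpace ℝ (Fin N) → ℝ) (hu₀ : MemLp u₀ ⊤ volume)
    (hu₀_zero : ∀ x ∉ Ω, u₀ x = 0) (u : ℝ → EuclideanSpace ℝ (Fin N) → ℝ)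
    (hu : IsWeakSolution Ω s m T u₀ u)
    (w : ℝ → EuclideanSpace ℝ (Fin N) → ℝ) (hw : w = wOf m u) (σ : ℝ) (hσ : 0 < σ) :
    ∃ c : ℝ, 0 < c ∧
      ∀ K : Geometry.SimplicialComplex ℝ (EuclideanSpace ℝ (Fin N)), IsTriangulation Ω σ K →
      ∀ (τ : ℝ) (M : ℕ), 0 < τ → M * τ = T →
      ∀ W : ℕ → EuclideanSpace ℝ (Fin N) → ℝ, IsDiscreteSolution Ω s m K τ M (w 0) W →
        ∫⁻ t in Set.Ioo 0 T,
            quasiNormSq Ω ((m + 1) / m) (w t) (fun x => w t x - stepInTime τ W t x)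
          ≤ ENNReal.ofReal c *
            ((∑ n ∈ Finset.Icc 1 M, ∫⁻ t in Set.Ioo (((n : ℝ) - 1) * τ) ((n : ℝ) * τ),
                quasiNormSq Ω ((m + 1) / m) (w t) (fun x => w ((n : ℝ) * τ) x - w t x)) +
              (∫⁻ t in Set.Ioo 0 T,
                quasiNormSq Ω ((m + 1) / m) (w t) (fun x => w t x - hsProjection Ω s K (w t) x)) +
              eLpNorm (fun x => psi m (w 0 x) - interpolant Ω K (fun y => psi m (w 0 y)) x)
                2 volume ^ 2) := by
  subst hw
  obtain ⟨C₀, C₁, hC₀, hC₁, hpt₀, hpt₁⟩ := exists_pointwise_error_bounds hm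
  obtain ⟨C_P, hC_P, hP⟩ := exists_poincare hN hs.1 hΩ.isBounded
  refine ⟨C₁ * (2 * C₀ + C_P + 1), by positivity, fun K hK τ M hτ hMT W hW => ?_⟩
  have hgap := ofReal_sum_gap_le hC₀.le hC_P hN hs hP hpt₀ hu₀ hu₀_zero hu hW hm hΩ hK hτ hMT
  rw [sum_Icc_one_eq_sum_range]
  have hcast : ∀ k : ℕ, (((k + 1 : ℕ) : ℝ) - 1) = k := fun k => by push_cast; ring
  simp only [hcast]
  set S₁ := ∑ k ∈ Finset.range M, ∫⁻ t in Ioo (k * τ) ((k + 1 : ℕ) * τ),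
    quasiNormSq Ω ((m + 1) / m) (wOf m u t)
      (fun x => wOf m u ((k + 1 : ℕ) * τ) x - wOf m u t x) with hS₁
  set S₂ := ∫⁻ t in Set.Ioo 0 T, quasiNormSq Ω ((m + 1) / m) (wOf m u t)
    (fun x => wOf m u t x - hsProjection Ω s K (wOf m u t) x)
  set Z := eLpNorm (fun x => psi m (wOf m u 0 x) -
    interpolant Ω K (fun y => psi m (wOf m u 0 y)) x) 2 volume ^ 2
  have gap_nonneg : ∀ k ∈ Finset.range M, 0 ≤
      τ * ((∫ x, psiGap m (wOf m u ((k + 1 : ℕ) * τ) x) (W (k + 1) x)) / 2) := fun k _ =>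
    mul_nonneg hτ.le (div_nonneg (integral_nonneg fun x => psiGap_nonneg hm _ _) zero_le_two)
  rw [ENNReal.ofReal_sum_of_nonneg gap_nonneg] at hgap
  calc _ ≤ ∑ k ∈ Finset.range M, ENNReal.ofReal C₁ * (2 * ENNReal.ofReal
          (τ * ((∫ x, psiGap m (wOf m u ((k + 1 : ℕ) * τ) x) (W (k + 1) x)) / 2)) +
        ∫⁻ t in Ioo (k * τ) ((k + 1 : ℕ) * τ), quasiNormSq Ω ((m + 1) / m) (wOf m u t)
          (fun x => wOf m u ((k + 1 : ℕ) * τ) x - wOf m u t x)) := by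
        rw [← hMT, setLIntegral_Ioo_eq_sum _ hτ]
        exact Finset.sum_le_sum fun k hk => setLIntegral_quasiNormSq_stepInTime_le hC₁.le hpt₁
          hu hW hm hΩ hK hτ hMT (Finset.mem_range.1 hk)
    _ = ENNReal.ofReal C₁ * (2 * (∑ k ∈ Finset.range M, ENNReal.ofReal
          (τ * ((∫ x, psiGap m (wOf m u ((k + 1 : ℕ) * τ) x) (W (k + 1) x)) / 2))) + S₁) := by
        rw [← Finset.mul_sum, Finset.sum_add_distrib, ← Finset.mul_sum, hS₁]
    _ ≤ ENNReal.ofReal C₁ * (2 * (ENNReal.ofReal C₀ * (S₁ + S₂) +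
          ENNReal.ofReal (C_P / 2) * Z) + S₁) := by gcongr
    _ = ENNReal.ofReal C₁ * ((ENNReal.ofReal (2 * C₀) + 1) * S₁ + ENNReal.ofReal (2 * C₀) * S₂ +
          ENNReal.ofReal C_P * Z) := by
        have e : ENNReal.ofReal C_P = 2 * ENNReal.ofReal (C_P / 2) := by
          rw [← ENNReal.ofReal_ofNat 2, ← ENNReal.ofReal_mul (by norm_num)]
          congr 1; ring
        rw [e, ENNReal.ofReal_mul (by norm_num : (0 : ℝ) ≤ 2), ENNReal.ofReal_ofNat]
        ring
    _ ≤ ENNReal.ofReal C₁ * (ENNReal.ofReal (2 * C₀ + C_P + 1) * S₁ +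
          ENNReal.ofReal (2 * C₀ + C_P + 1) * S₂ + ENNReal.ofReal (2 * C₀ + C_P + 1) * Z) := by
        gcongr
        · rw [← ENNReal.ofReal_one, ← ENNReal.ofReal_add (by positivity) zero_le_one]
          exact ENNReal.ofReal_le_ofReal (by linarith)
        · linarith
        · linarith
    _ = _ := by
        rw [ENNReal.ofReal_mul hC₁.le]
        ring
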